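/- Fix a set of total binary arithmetic operators $\odot$ on $\mathbb{N}$ containing $+$ and (truncated) $-$. **The languages.** The types are $A ::= \mathtt{nat} \mid \mathtt{comm} \mid \mathtt{var} \mid A \multimap A$. Let $\mathrm{SCI}_{\mathtt{mk},\mathtt{ran}}$ be the language of terms (up to $\alpha$-equivalence) $$M ::= n \mid M\odot M \mid \mathtt{skip} \mid M;M \mid M:=M \mid {!M} \mid \mathtt{while}\,M\,\mathtt{do}\,M \mid \mathtt{ifzero}\,M\,M\,M \mid x \mid \lambda x^A.M \mid MM \mid \mathtt{new}\,x\,\mathtt{in}\,M \mid \mathtt{mkvar}\,M\,M \mid \mathtt{random},$$ and let $\mathrm{SCI}_{\mathtt{mk}}$ be its fragment without $\mathtt{random}$. Typing judgements $\Gamma\vdash M:A$, where $\Gamma$ is a list of identifier–type pairs with distinct identifiers, are those of Reynolds's Syntactic Control of Interference. There are the axioms $x:A\vdash x:A$, $\vdash n:\mathtt{nat}$, $\vdash\mathtt{skip}:\mathtt{comm}$ and $\Gamma\vdash\mathtt{random}:\mathtt{nat}$; weakening and exchange; from $\Gamma,x:A\vdash M:B$ infer $\Gamma\vdash\lambda x^A.M:A\multimap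 B$; from $\Gamma\vdash M:A\multimap B$ and $\Delta\vdash N:A$, with $\Gamma$ and $\Delta$ having no identifier in common, infer $\Gamma,\Delta\vdash MN:B$. All further formers let their parts share the context $\Gamma$: * $M\odot N:\mathtt{nat}$ for $M,N:\mathtt{nat}$; * $M;N:B$ for $M:\mathtt{comm}$, $N:B$, and $\mathtt{ifzero}\,M\,N_1\,N_2:B$ for $M:\mathtt{nat}$, $N_1,N_2:B$, where $B\in\{\mathtt{comm},\mathtt{nat},\mathtt{var}\}$; * $M:=N:\mathtt{comm}$ and $!M:\mathtt{nat}$ for $M:\mathtt{var}$, $N:\mathtt{nat}$; * $\mathtt{while}\,M\,\mathtt{do}\,N:\mathtt{comm}$ for $M:\mathtt{nat}$, $N:\mathtt{comm}$; * $\mathtt{mkvar}\,M\,N:\mathtt{var}$ for $M:\mathtt{nat}\multimap\mathtt{comm}$, $N:\mathtt{nat}$; * $\Gamma\vdash\mathtt{new}\,x\,\mathtt{in}\,M:B$ for $\Gamma,x:\mathtt{var}\vdash M:B$ and $B\in\{\mathtt{comm},\mathtt{nat}\}$. **Evaluation.** A store $\sigma$ is a function from a finite set of identifiers to $\mathbb{N}$.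 Values are numerals, $\mathtt{skip}$, identifiers, abstractions and terms $\mathtt{mkvar}\,M\,N$. The big-step relation $\sigma,M\Downarrow\sigma',V$ is defined inductively, passing the store from each evaluation to the next: * a value evaluates to itself; $\sigma,\mathtt{random}\Downarrow\sigma,n$ for every $n\in\mathbb{N}$; * $MN$ evaluates $M$ to some $\lambda x^A.M'$ and then evaluates $M'[N/x]$ (call-by-name); * $M_1\odot M_2$ evaluates $M_1$, then $M_2$, and applies $\odot$ to the two numerals; * $M;N$ evaluates $M$ to $\mathtt{skip}$, then evaluates $N$; $\mathtt{ifzero}\,M\,N_1\,N_2$ evaluates $M$, then $N_1$ if the result is $0$ and $N_2$ otherwise; $\mathtt{while}\,M\,\mathtt{do}\,N$ evaluates $M$, ends with $\mathtt{skip}$ if the result is nonzero, and otherwise evaluates $N$ to $\mathtt{skip}$ and then the loop again; * $M:=N$ evaluates $N$ to a numeral $n$ and then $M$ to an identifier $x$, in which case $x$ is set to $n$ and the result is $\mathtt{skip}$, or to $\mathtt{mkvar}\,M_1\,M_2$, in which case $M_1\,n$ is evaluated; * $!M$ evaluates $M$ to an identifier $x$ and returns the value stored at $x$, or to $\mathtt{mkvar}\,M_1\,M_2$,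 in which case $M_2$ is evaluated; * $\mathtt{new}\,x\,\mathtt{in}\,M$ ($x$ fresh) evaluates $M$ in the store extended by $x\mapsto 0$ and removes $x$ from the resulting store. For a closed term $M$, write $M\Downarrow V$ if $\emptyset,M\Downarrow\emptyset,V$. **Contextual equivalence.** Let $L$ be one of the two languages. Terms $\Gamma\vdash M,N:A$ of $L$ are contextually equivalent in $L$ if for every context $C[-]$ of $L$ (a term with holes; filling a hole may capture identifiers) such that $\vdash C[M],C[N]:B$ with $B\in\{\mathtt{comm},\mathtt{nat}\}$, and every value $\vdash V:B$, one has $C[M]\Downarrow V\iff C[N]\Downarrow V$. The relation is written $\cong_{\mathtt{mk}}$ for $\mathrm{SCI}_{\mathtt{mk}}$ and $\cong_{\mathtt{mk},\mathtt{ran}}$ for $\mathrm{SCI}_{\mathtt{mk},\mathtt{ran}}$. **Statement ($\mathtt{random}$ is conservative).** Let $\Gamma\vdash M,N:A$ be terms of $\mathrm{SCI}_{\mathtt{mk}}$ such that $M\cong_{\mathtt{mk}}N$. Then $M\cong_{\mathtt{mk},\mathtt{ran}}N$. -/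

import Mathlib

namespace SCI

universe u

/-- Types: `A ::= nat | comm | var | A ⊸ A`. -/
inductive Ty : Type
  | nat
  | comm
  | var
  | fn (A B : Ty)

/-- The binary arithmetic operators: `+`, `-`, and an arbitrary family `ι` of further ones. -/
inductive BinOp (ι : Type u) : Type u
  | add
  | sub
  | other (i : ι)

/-- Meaning of the operators; `-` is subtraction of natural numbers (`a - b = 0` for `a ≤ b`). -/
def BinOp.eval {ι : Type u} (opEval : ι → ℕ → ℕ → ℕ) : BinOp ι → ℕ → ℕ → ℕ
  | .add, a, b => a + b
  | .sub, a, b => a - b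
  | .other i, a, b => opEval i a b

/-- Terms up to α-equivalence, in locally nameless form: identifiers (free variables) are named by
natural numbers, bound variables are de Bruijn indices. `lam A M` and `new M` bind index `0`
in `M`. Only terms without dangling indices are typable. -/
inductive Tm (ι : Type u) : Type u
  | fvar (x : ℕ)
  | bvar (i : ℕ)
  | num (n : ℕ)
  | op (o : BinOp ι) (M N : Tm ι)
  | skip
  | seq (M N : Tm ι)
  | assign (M N : Tm ι)
  | deref (M : Tm ι)
  | while (M N : Tm ι)
  | ifzero (M N₁ N₂ : Tm ι)
  | lam (A : Ty) (M : Tm ι)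
  | app (M N : Tm ι)
  | new (M : Tm ι)
  | mkvar (M N : Tm ι)
  | random

namespace Tm

variable {ι : Type u}

/-- The free identifiers of a term. -/
def fv : Tm ι → Finset ℕ
  | fvar x => {x}
  | bvar _ => ∅
  | num _ => ∅
  | op _ M N => M.fv ∪ N.fv
  | skip => ∅
  | seq M N => M.fv ∪ N.fv
  | assign M N => M.fv ∪ N.fv
  | deref M => M.fv
  | .while M N => M.fv ∪ N.fv
  | ifzero M N₁ N₂ => M.fv ∪ N₁.fv ∪ N₂.fv
  | lam _ M => M.fv
  | app M N => M.fv ∪ N.fv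
  | new M => M.fv
  | mkvar M N => M.fv ∪ N.fv
  | random => ∅

/-- Replace the bound variable with index `k` by the term `P` (which has no dangling indices). -/
def instAt (P : Tm ι) : ℕ → Tm ι → Tm ι
  | _, fvar x => fvar x
  | k, bvar i => if i = k then P else bvar i
  | _, num n => num n
  | k, op o M N => op o (instAt P k M) (instAt P k N)
  | _, skip => skip
  | k, seq M N => seq (instAt P k M) (instAt P k N)
  | k, assign M N => assign (instAt P k M) (instAt P k N)
  | k, deref M => deref (instAt P k M)
  | k, .while M N => .while (instAt P k M) (instAt P k N)
  | k, ifzero M N₁ N₂ => ifzero (instAt P k M) (instAt P k N₁) (instAt P k N₂)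
  | k, lam A M => lam A (instAt P (k + 1) M)
  | k, app M N => app (instAt P k M) (instAt P k N)
  | k, new M => new (instAt P (k + 1) M)
  | k, mkvar M N => mkvar (instAt P k M) (instAt P k N)
  | _, random => random

/-- `M.inst P`: the body `M` of a binder with `P` substituted for the variable it binds. -/
def inst (M P : Tm ι) : Tm ι := instAt P 0 M

/-- Turn the identifier `x` into the bound variable with index `k`. -/
def closeAt (x : ℕ) : ℕ → Tm ι → Tm ι
  | k, fvar y => if y = x then bvar k else fvar y
  | _, bvar i => bvar i
  | _, num n => num n
  | k, op o M N => op o (closeAt x k M) (closeAt x k N)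
  | _, skip => skip
  | k, seq M N => seq (closeAt x k M) (closeAt x k N)
  | k, assign M N => assign (closeAt x k M) (closeAt x k N)
  | k, deref M => deref (closeAt x k M)
  | k, .while M N => .while (closeAt x k M) (closeAt x k N)
  | k, ifzero M N₁ N₂ => ifzero (closeAt x k M) (closeAt x k N₁) (closeAt x k N₂)
  | k, lam A M => lam A (closeAt x (k + 1) M)
  | k, app M N => app (closeAt x k M) (closeAt x k N)
  | k, new M => new (closeAt x (k + 1) M)
  | k, mkvar M N => mkvar (closeAt x k M) (closeAt x k N)
  | _, random => random

/-- The named abstraction `λ x^A. M`. -/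
def namedLam (x : ℕ) (A : Ty) (M : Tm ι) : Tm ι := lam A (closeAt x 0 M)

/-- The named block `new x in M`. -/
def namedNew (x : ℕ) (M : Tm ι) : Tm ι := new (closeAt x 0 M)

/-- Values: numerals, `skip`, identifiers, abstractions and `mkvar` terms. -/
inductive IsValue : Tm ι → Prop
  | fvar (x : ℕ) : IsValue (fvar x)
  | num (n : ℕ) : IsValue (num n)
  | skip : IsValue skip
  | lam (A : Ty) (M : Tm ι) : IsValue (lam A M)
  | mkvar (M N : Tm ι) : IsValue (mkvar M N)

end Tm

/-- The two languages: SCI with `mkvar`, and SCI with `mkvar` and `random`. -/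
inductive Lang : Type
  | mk
  | mkran

/-- Typing contexts `x₁ : A₁, …, xₙ : Aₙ`. -/
abbrev TyCtx : Type := List (ℕ × Ty)

/-- The identifiers of a typing context. -/
def TyCtx.ids (Γ : TyCtx) : List ℕ := Γ.map Prod.fst

/-- Well-formed typing contexts: the identifiers are distinct. -/
def TyCtx.WF (Γ : TyCtx) : Prop := Γ.ids.Nodup

/-- `HasType L Γ M A`: the affine typing judgement `Γ ⊢ M : A` of the language `L`. Every derivable
judgement has a well-formed context. The two languages differ in the rule for `random` only. -/
inductive HasType {ι : Type u} (L : Lang) : TyCtx → Tm ι → Ty → Prop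
  | var (x : ℕ) (A : Ty) : HasType L [(x, A)] (.fvar x) A
  | lam {Γ : TyCtx} {x : ℕ} {A B : Ty} {M : Tm ι} (hx : x ∉ M.fv)
      (hM : HasType L (Γ ++ [(x, A)]) (M.inst (.fvar x)) B) :
      HasType L Γ (.lam A M) (.fn A B)
  | app {Γ Δ : TyCtx} {A B : Ty} {M N : Tm ι} (hM : HasType L Γ M (.fn A B))
      (hN : HasType L Δ N A) (hwf : TyCtx.WF (Γ ++ Δ)) :
      HasType L (Γ ++ Δ) (.app M N) B
  | weakening {Γ : TyCtx} {x : ℕ} {A B : Ty} {M : Tm ι} (hM : HasType L Γ M B)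
      (hwf : TyCtx.WF (Γ ++ [(x, A)])) : HasType L (Γ ++ [(x, A)]) M B
  | exchange {Γ Γ' : TyCtx} {A : Ty} {M : Tm ι} (hM : HasType L Γ M A) (hp : Γ.Perm Γ') :
      HasType L Γ' M A
  | num (n : ℕ) : HasType L [] (.num n) .nat
  | op {Γ : TyCtx} {M N : Tm ι} (o : BinOp ι) (hM : HasType L Γ M .nat)
      (hN : HasType L Γ N .nat) : HasType L Γ (.op o M N) .nat
  | skip : HasType L [] .skip .comm
  | seq {Γ : TyCtx} {B : Ty} {M N : Tm ι} (hM : HasType L Γ M .comm) (hN : HasType L Γ N B)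
      (hB : B = .comm ∨ B = .nat ∨ B = .var) : HasType L Γ (.seq M N) B
  | assign {Γ : TyCtx} {M N : Tm ι} (hM : HasType L Γ M .var) (hN : HasType L Γ N .nat) :
      HasType L Γ (.assign M N) .comm
  | deref {Γ : TyCtx} {M : Tm ι} (hM : HasType L Γ M .var) : HasType L Γ (.deref M) .nat
  | while {Γ : TyCtx} {M N : Tm ι} (hM : HasType L Γ M .nat) (hN : HasType L Γ N .comm) :
      HasType L Γ (.while M N) .comm
  | ifzero {Γ : TyCtx} {B : Ty} {M N₁ N₂ : Tm ι} (hM : HasType L Γ M .nat)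
      (hN₁ : HasType L Γ N₁ B) (hN₂ : HasType L Γ N₂ B)
      (hB : B = .comm ∨ B = .nat ∨ B = .var) : HasType L Γ (.ifzero M N₁ N₂) B
  | new {Γ : TyCtx} {x : ℕ} {B : Ty} {M : Tm ι} (hx : x ∉ M.fv)
      (hM : HasType L (Γ ++ [(x, .var)]) (M.inst (.fvar x)) B)
      (hB : B = .comm ∨ B = .nat) : HasType L Γ (.new M) B
  | mkvar {Γ : TyCtx} {M N : Tm ι} (hM : HasType L Γ M (.fn .nat .comm))
      (hN : HasType L Γ N .nat) : HasType L Γ (.mkvar M N) .var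
  | random {Γ : TyCtx} (hL : L = .mkran) (hwf : TyCtx.WF Γ) : HasType L Γ .random .nat

/-- Stores: functions from a finite set of identifiers to the natural numbers. -/
abbrev Store : Type := Finmap (fun _ : ℕ => ℕ)

/-- The evaluation judgement `σ, M ⇓ σ', V`. It is applied to typable terms only, whose evaluation
stays within typable terms, so that no typing information is carried along. -/
inductive Eval {ι : Type u} (opEval : ι → ℕ → ℕ → ℕ) : Store → Tm ι → Store → Tm ι → Prop
  | value {σ : Store} {V : Tm ι} (hV : V.IsValue) : Eval opEval σ V σ V
  | app {σ σ' σ'' : Store} {A : Ty} {M M' N V : Tm ι}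
      (h₁ : Eval opEval σ M σ' (.lam A M')) (h₂ : Eval opEval σ' (M'.inst N) σ'' V) :
      Eval opEval σ (.app M N) σ'' V
  | op {σ σ' σ'' : Store} {M₁ M₂ : Tm ι} {n₁ n₂ : ℕ} (o : BinOp ι)
      (h₁ : Eval opEval σ M₁ σ' (.num n₁)) (h₂ : Eval opEval σ' M₂ σ'' (.num n₂)) :
      Eval opEval σ (.op o M₁ M₂) σ'' (.num (o.eval opEval n₁ n₂))
  | assign {σ σ' σ'' : Store} {M N : Tm ι} {x n : ℕ}
      (h₁ : Eval opEval σ N σ' (.num n)) (h₂ : Eval opEval σ' M σ'' (.fvar x)) :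
      Eval opEval σ (.assign M N) (σ''.insert x n) .skip
  | deref {σ σ' : Store} {M : Tm ι} {x n : ℕ}
      (h₁ : Eval opEval σ M σ' (.fvar x)) (hx : σ'.lookup x = some n) :
      Eval opEval σ (.deref M) σ' (.num n)
  | seq {σ σ' σ'' : Store} {M N V : Tm ι}
      (h₁ : Eval opEval σ M σ' .skip) (h₂ : Eval opEval σ' N σ'' V) :
      Eval opEval σ (.seq M N) σ'' V
  | while_exit {σ σ' : Store} {M N : Tm ι} {n : ℕ}
      (h₁ : Eval opEval σ M σ' (.num n)) (hn : n ≠ 0) :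
      Eval opEval σ (.while M N) σ' .skip
  | while_loop {σ σ' σ'' σ''' : Store} {M N : Tm ι}
      (h₁ : Eval opEval σ M σ' (.num 0)) (h₂ : Eval opEval σ' N σ'' .skip)
      (h₃ : Eval opEval σ'' (.while M N) σ''' .skip) :
      Eval opEval σ (.while M N) σ''' .skip
  | ifzero_zero {σ σ' σ'' : Store} {M N₁ N₂ V : Tm ι}
      (h₁ : Eval opEval σ M σ' (.num 0)) (h₂ : Eval opEval σ' N₁ σ'' V) :
      Eval opEval σ (.ifzero M N₁ N₂) σ'' V
  | ifzero_ne {σ σ' σ'' : Store} {M N₁ N₂ V : Tm ι} {n : ℕ}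
      (h₁ : Eval opEval σ M σ' (.num n)) (hn : n ≠ 0) (h₂ : Eval opEval σ' N₂ σ'' V) :
      Eval opEval σ (.ifzero M N₁ N₂) σ'' V
  | new {σ σ' : Store} {M V : Tm ι} {x n : ℕ} (hM : x ∉ M.fv) (hV : x ∉ V.fv)
      (hσ : x ∉ σ) (hσ' : x ∉ σ')
      (h : Eval opEval (σ.insert x 0) (M.inst (.fvar x)) (σ'.insert x n) V) :
      Eval opEval σ (.new M) σ' V
  | assign_mkvar {σ σ' σ'' σ''' : Store} {M N M₁ M₂ V : Tm ι} {n : ℕ}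
      (h₁ : Eval opEval σ N σ' (.num n)) (h₂ : Eval opEval σ' M σ'' (.mkvar M₁ M₂))
      (h₃ : Eval opEval σ'' (.app M₁ (.num n)) σ''' V) :
      Eval opEval σ (.assign M N) σ''' V
  | deref_mkvar {σ σ' σ'' : Store} {M M₁ M₂ V : Tm ι}
      (h₁ : Eval opEval σ M σ' (.mkvar M₁ M₂)) (h₂ : Eval opEval σ' M₂ σ'' V) :
      Eval opEval σ (.deref M) σ'' V
  | random {σ : Store} (n : ℕ) : Eval opEval σ .random σ (.num n)

/-- Program contexts `C[-]`: terms with holes. Their binders are named, because filling a hole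
captures identifiers. -/
inductive Context (ι : Type u) : Type u
  | hole
  | id (x : ℕ)
  | num (n : ℕ)
  | op (o : BinOp ι) (C D : Context ι)
  | skip
  | seq (C D : Context ι)
  | assign (C D : Context ι)
  | deref (C : Context ι)
  | while (C D : Context ι)
  | ifzero (C D₁ D₂ : Context ι)
  | lam (x : ℕ) (A : Ty) (C : Context ι)
  | app (C D : Context ι)
  | new (x : ℕ) (C : Context ι)
  | mkvar (C D : Context ι)
  | random

/-- `C.fill M` is the term `C[M]`. -/
def Context.fill {ι : Type u} (M : Tm ι) : Context ι → Tm ι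
  | .hole => M
  | .id x => .fvar x
  | .num n => .num n
  | .op o C D => .op o (C.fill M) (D.fill M)
  | .skip => .skip
  | .seq C D => .seq (C.fill M) (D.fill M)
  | .assign C D => .assign (C.fill M) (D.fill M)
  | .deref C => .deref (C.fill M)
  | .while C D => .while (C.fill M) (D.fill M)
  | .ifzero C D₁ D₂ => .ifzero (C.fill M) (D₁.fill M) (D₂.fill M)
  | .lam x A C => Tm.namedLam x A (C.fill M)
  | .app C D => .app (C.fill M) (D.fill M)
  | .new x C => Tm.namedNew x (C.fill M)
  | .mkvar C D => .mkvar (C.fill M) (D.fill M)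
  | .random => .random

/-- Contextual equivalence in the language `L`: for every context `C[-]` such that
`⊢ C[M], C[N] : B` in `L` with `B` one of `comm`, `nat`, and every value `⊢ V : B`, one has
`C[M] ⇓ V` iff `C[N] ⇓ V`. For `L = mk` the typing of `C[M]` forces `C[-]` to be free of
`random`. -/
def CtxEquiv {ι : Type u} (L : Lang) (opEval : ι → ℕ → ℕ → ℕ) (M N : Tm ι) : Prop :=
  ∀ (C : Context ι) (B : Ty), (B = .comm ∨ B = .nat) →
    HasType L [] (C.fill M) B → HasType L [] (C.fill N) B →
    ∀ V : Tm ι, V.IsValue → HasType L [] V B →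
      (Eval opEval ∅ (C.fill M) ∅ V ↔ Eval opEval ∅ (C.fill N) ∅ V)

end SCI

/-! A converging evaluation is finite, so each occurrence of `random` in a context is asked for only
finitely many numbers. For one particular evaluation of `C[M]` these numbers can be written into a
table, and the occurrence replaced by a deterministic generator `Tm.gen r T`, which steps through
the table `T` with a counter stored at `r`. The counter is declared by a `new r` around the whole
program, so it survives every re-evaluation of the occurrence in loops and call-by-name copies.

Two facts about this replacement carry the proof. By `Eval.subst_gen`, the given evaluation of
`C[M]` is reproduced when the table lists exactly the numbers it drew. Conversely, by
`Eval.subst_random`, every evaluation with the generator is, after forgetting `r`, an evaluation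
with `random`, because `random` may return anything the generator returns. So `C[M] ⇓ V` gives
`C'[M] ⇓ V` for the modified context `C'`; equivalence gives `C'[N] ⇓ V`, and hence `C[N] ⇓ V`.

Typing forces the occurrences to be treated one at a time, each with its own location: a counter
shared by a function and its argument would violate the affine rule for application. A single
occurrence lies on one side of every application, so `r` can follow it (`HasType.subst_gen`).
`Context.exists_isFocus` isolates such an occurrence, and `CtxEquiv.eval_fill` runs the induction on
the number of occurrences of `random` in the context. -/

namespace SCI

universe v

variable {ι : Type v}

/-! ### Syntax: substitution for identifiers, dangling indices, and the table-driven generator -/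

namespace Tm

/-- Replace the identifier `r` by the term `Q` (which has no dangling indices). -/
def subst (r : ℕ) (Q : Tm ι) : Tm ι → Tm ι
  | fvar y => if y = r then Q else fvar y
  | bvar i => bvar i
  | num n => num n
  | op o M N => op o (subst r Q M) (subst r Q N)
  | skip => skip
  | seq M N => seq (subst r Q M) (subst r Q N)
  | assign M N => assign (subst r Q M) (subst r Q N)
  | deref M => deref (subst r Q M)
  | .while M N => .while (subst r Q M) (subst r Q N)
  | ifzero M N₁ N₂ => ifzero (subst r Q M) (subst r Q N₁) (subst r Q N₂)
  | lam A M => lam A (subst r Q M)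
  | app M N => app (subst r Q M) (subst r Q N)
  | new M => new (subst r Q M)
  | mkvar M N => mkvar (subst r Q M) (subst r Q N)
  | random => random

/-- The number of occurrences of the identifier `r`. -/
def occ (r : ℕ) : Tm ι → ℕ
  | fvar y => if y = r then 1 else 0
  | bvar _ => 0
  | num _ => 0
  | op _ M N => occ r M + occ r N
  | skip => 0
  | seq M N => occ r M + occ r N
  | assign M N => occ r M + occ r N
  | deref M => occ r M
  | .while M N => occ r M + occ r N
  | ifzero M N₁ N₂ => occ r M + occ r N₁ + occ r N₂
  | lam _ M => occ r M
  | app M N => occ r M + occ r N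
  | new M => occ r M
  | mkvar M N => occ r M + occ r N
  | random => 0

/-- All dangling indices are below `k`. -/
def LcAt : ℕ → Tm ι → Prop
  | _, fvar _ => True
  | k, bvar i => i < k
  | _, num _ => True
  | k, op _ M N => LcAt k M ∧ LcAt k N
  | _, skip => True
  | k, seq M N => LcAt k M ∧ LcAt k N
  | k, assign M N => LcAt k M ∧ LcAt k N
  | k, deref M => LcAt k M
  | k, .while M N => LcAt k M ∧ LcAt k N
  | k, ifzero M N₁ N₂ => LcAt k M ∧ LcAt k N₁ ∧ LcAt k N₂
  | k, lam _ M => LcAt (k + 1) M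
  | k, app M N => LcAt k M ∧ LcAt k N
  | k, new M => LcAt (k + 1) M
  | k, mkvar M N => LcAt k M ∧ LcAt k N
  | _, random => True

/-- The term does not contain `random`. -/
def RandomFree : Tm ι → Prop
  | fvar _ => True
  | bvar _ => True
  | num _ => True
  | op _ M N => RandomFree M ∧ RandomFree N
  | skip => True
  | seq M N => RandomFree M ∧ RandomFree N
  | assign M N => RandomFree M ∧ RandomFree N
  | deref M => RandomFree M
  | .while M N => RandomFree M ∧ RandomFree N
  | ifzero M N₁ N₂ => RandomFree M ∧ RandomFree N₁ ∧ RandomFree N₂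
  | lam _ M => RandomFree M
  | app M N => RandomFree M ∧ RandomFree N
  | new M => RandomFree M
  | mkvar M N => RandomFree M ∧ RandomFree N
  | random => False

/-- Choose the entry of the list `T` whose position, counted from `j`, is stored at `r`. -/
def look (r : ℕ) : List ℕ → ℕ → Tm ι
  | [], _ => num 0
  | a :: T, j => ifzero (op .sub (deref (fvar r)) (num j)) (num a) (look r T (j + 1))

/-- Increment the counter `r` and return the entry of `T` it pointed to. -/
def gen (r : ℕ) (T : List ℕ) : Tm ι :=
  seq (assign (fvar r) (op .add (deref (fvar r)) (num 1))) (look r T 1)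

section Syntactic

variable {r x : ℕ} {Q : Tm ι}

theorem occ_eq_zero_iff (M : Tm ι) : occ r M = 0 ↔ r ∉ M.fv := by
  induction M <;> simp_all [occ, fv, and_assoc]
  exact ne_comm

theorem subst_eq_self {M : Tm ι} (h : r ∉ M.fv) : subst r Q M = M := by
  induction M <;> simp_all [subst, fv]
  exact fun e => absurd e.symm h

theorem occ_instAt_fvar (hx : x ≠ r) (M : Tm ι) (k : ℕ) :
    occ r (instAt (fvar x) k M) = occ r M := by
  induction M generalizing k <;> simp_all [occ, instAt]
  split_ifs <;> simp_all [occ]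

theorem occ_closeAt (hx : x ≠ r) (M : Tm ι) (k : ℕ) : occ r (closeAt x k M) = occ r M := by
  induction M generalizing k <;> simp_all [occ, closeAt]
  split_ifs <;> simp_all [occ]

theorem subst_instAt (hQ : ∀ (P : Tm ι) (k : ℕ), instAt P k Q = Q) (P M : Tm ι) (k : ℕ) :
    subst r Q (instAt P k M) = instAt (subst r Q P) k (subst r Q M) := by
  induction M generalizing k <;> simp_all [subst, instAt]
  all_goals split_ifs <;> simp_all [subst, instAt]

theorem subst_inst (hQ : ∀ (P : Tm ι) (k : ℕ), instAt P k Q = Q) (P M : Tm ι) :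
    subst r Q (M.inst P) = (subst r Q M).inst (subst r Q P) :=
  subst_instAt hQ P M 0

theorem subst_inst_fvar (hQ : ∀ (P : Tm ι) (k : ℕ), instAt P k Q = Q) (hx : x ≠ r) (M : Tm ι) :
    subst r Q (M.inst (fvar x)) = (subst r Q M).inst (fvar x) := by
  rw [subst_inst hQ]
  simp [subst, hx]

theorem subst_closeAt (hQ : ∀ k : ℕ, closeAt x k Q = Q) (hx : x ≠ r) (M : Tm ι) (k : ℕ) :
    subst r Q (closeAt x k M) = closeAt x k (subst r Q M) := by
  induction M generalizing k <;> simp_all [subst, closeAt]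
  split_ifs <;> simp_all [subst, closeAt]

theorem mem_fv_subst (hQ : x ∉ Q.fv) (hx : x ≠ r) (M : Tm ι) :
    x ∈ (subst r Q M).fv ↔ x ∈ M.fv := by
  induction M <;> simp_all [subst, fv]
  split_ifs <;> simp_all [fv]

theorem fv_closeAt (M : Tm ι) (k : ℕ) : (closeAt x k M).fv = M.fv.erase x := by
  induction M generalizing k <;> simp_all [closeAt, fv, Finset.erase_union_distrib]
  split_ifs <;> simp_all [fv, eq_comm]

theorem lcAt_of_instAt {M : Tm ι} {k : ℕ} (h : LcAt k (instAt (fvar x) k M)) :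
    LcAt (k + 1) M := by
  induction M generalizing k <;> simp_all [instAt, LcAt]
  split_ifs at h <;> simp_all [LcAt]; omega

theorem lcAt_of_subst {M : Tm ι} {k : ℕ} (h : LcAt k (subst r Q M)) : LcAt k M := by
  induction M generalizing k <;> simp_all [subst, LcAt]

theorem lcAt_subst {M : Tm ι} {k : ℕ} (hQ : ∀ k, LcAt k Q) (h : LcAt k M) :
    LcAt k (subst r Q M) := by
  induction M generalizing k <;> simp_all [subst, LcAt]
  split_ifs <;> simp_all [LcAt]

theorem instAt_closeAt_self {M : Tm ι} {k : ℕ} (h : LcAt k M) :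
    instAt (fvar r) k (closeAt r k M) = M := by
  induction M generalizing k <;> simp_all [instAt, closeAt, LcAt]
  · split_ifs <;> simp_all [instAt]
  · omega

theorem randomFree_instAt_fvar (M : Tm ι) (k : ℕ) :
    (instAt (fvar x) k M).RandomFree ↔ M.RandomFree := by
  induction M generalizing k <;> simp_all [instAt, RandomFree]
  split_ifs <;> simp [RandomFree]

theorem randomFree_closeAt (M : Tm ι) (k : ℕ) : (closeAt x k M).RandomFree ↔ M.RandomFree := by
  induction M generalizing k <;> simp_all [closeAt, RandomFree]
  split_ifs <;> simp [RandomFree]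

theorem instAt_look (P : Tm ι) (k : ℕ) (T : List ℕ) (j : ℕ) :
    instAt P k (look r T j) = look r T j := by
  induction T generalizing j <;> simp_all [look, instAt]

theorem instAt_gen (P : Tm ι) (k : ℕ) (T : List ℕ) : instAt P k (gen r T) = gen r T := by
  simp [gen, instAt, instAt_look]

theorem closeAt_look (hx : x ≠ r) (k : ℕ) (T : List ℕ) (j : ℕ) :
    closeAt x k (look r T j : Tm ι) = look r T j := by
  induction T generalizing j <;> simp_all [look, closeAt, hx.symm]

theorem closeAt_gen (hx : x ≠ r) (k : ℕ) (T : List ℕ) :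
    closeAt x k (gen r T : Tm ι) = gen r T := by
  simp [gen, closeAt, closeAt_look hx, hx.symm]

theorem instAt_closeAt_look (k : ℕ) (T : List ℕ) (j : ℕ) :
    instAt (fvar x) k (closeAt r k (look r T j : Tm ι)) = look x T j := by
  induction T generalizing j <;> simp_all [look, closeAt, instAt]

theorem instAt_closeAt_gen (k : ℕ) (T : List ℕ) :
    instAt (fvar x) k (closeAt r k (gen r T : Tm ι)) = gen x T := by
  simp [gen, closeAt, instAt, instAt_closeAt_look]

theorem fv_look (T : List ℕ) (j : ℕ) : (look r T j : Tm ι).fv ⊆ {r} := by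
  induction T generalizing j with
  | nil => simp [look, fv]
  | cons a T ih => 
    have := ih (j + 1)
    simp [look, fv, Finset.insert_subset_iff, this, -Finset.subset_singleton_iff]

theorem notMem_fv_gen (hx : x ≠ r) (T : List ℕ) : x ∉ (gen r T : Tm ι).fv := by
  have : x ∉ (look r T 1 : Tm ι).fv := fun h => hx (Finset.mem_singleton.1 (fv_look T 1 h))
  simp [gen, fv, hx, this]

theorem lcAt_look (T : List ℕ) (j k : ℕ) : LcAt k (look r T j : Tm ι) := by
  induction T generalizing j <;> simp_all [look, LcAt]

theorem lcAt_gen (T : List ℕ) (k : ℕ) : LcAt k (gen r T : Tm ι) := by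
  simp [gen, LcAt, lcAt_look]

/-- Evaluating `new` chooses its own location `x`, which need not be the identifier `r` that was
bound. Renaming `r` to `x` renames the counter inside the generator as well; `x` must be `r` or
fresh so that no other occurrence is confused with the marker. -/
theorem instAt_closeAt_subst_gen {M : Tm ι} {k : ℕ} (T : List ℕ) (hM : LcAt k M)
    (hx : x ∈ M.fv → x = r) :
    instAt (fvar x) k (closeAt r k (subst r (gen r T) M)) =
      subst x (gen x T) (instAt (fvar x) k (closeAt r k M)) := by
  induction M generalizing k <;> simp_all [subst, closeAt, instAt, LcAt, fv]
  case fvar y =>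
    split_ifs
    · simp [instAt_closeAt_gen, instAt, subst]
    · have : y ≠ x := by rintro rfl; simp_all
      simp [closeAt, instAt, subst, *]
  case bvar i =>
    have : i ≠ k := by omega
    simp [this, subst]

theorem subst_random_instAt_closeAt {M : Tm ι} {k : ℕ} (hM : LcAt k M)
    (hx : x ∈ M.fv → x = r) :
    subst x random (instAt (fvar x) k (closeAt r k M)) = subst r random M := by
  induction M generalizing k <;> simp_all [subst, closeAt, instAt, LcAt, fv]
  case fvar y =>
    split_ifs
    · simp [instAt, subst]
    · have : y ≠ x := by rintro rfl; simp_all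
      simp [instAt, subst, *]
  case bvar i =>
    have : i ≠ k := by omega
    simp [this, subst]

end Syntactic

end Tm

/-! ### Basic facts about typing -/

namespace HasType

variable {L : Lang} {Γ Δ : TyCtx} {M : Tm ι} {A B : Ty}

theorem wf_of_append (h : TyCtx.WF (Γ ++ Δ)) : Γ.WF := by
  rw [TyCtx.WF, TyCtx.ids, List.map_append] at h
  exact h.of_append_left

theorem lcAt (h : HasType L Γ M A) : M.LcAt 0 := by
  induction h <;> simp_all [Tm.LcAt]
  all_goals exact Tm.lcAt_of_instAt (by assumption)

theorem weaken (h : HasType L Γ M A) (hwf : TyCtx.WF (Γ ++ Δ)) : HasType L (Γ ++ Δ) M A := by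
  induction Δ generalizing Γ with
  | nil => simpa using h
  | cons p Δ ih =>
    have e : Γ ++ p :: Δ = (Γ ++ [p]) ++ Δ := by simp
    rw [e] at hwf ⊢
    exact ih (h.weakening (wf_of_append hwf)) hwf

theorem randomFree (h : HasType .mk Γ M A) : M.RandomFree := by
  induction h <;> simp_all [Tm.RandomFree, Tm.inst, Tm.randomFree_instAt_fvar]

theorem mk_of_randomFree (h : HasType L Γ M A) (hM : M.RandomFree) : HasType .mk Γ M A := by
  induction h with
  | var x A => exact .var x A
  | lam hx _ ih => exact .lam hx (ih ((Tm.randomFree_instAt_fvar _ _).2 hM))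
  | app _ _ hwf ih₁ ih₂ => exact .app (ih₁ hM.1) (ih₂ hM.2) hwf
  | weakening _ hwf ih => exact .weakening (ih hM) hwf
  | exchange _ hp ih => exact .exchange (ih hM) hp
  | num n => exact .num n
  | op o _ _ ih₁ ih₂ => exact .op o (ih₁ hM.1) (ih₂ hM.2)
  | skip => exact .skip
  | seq _ _ hB ih₁ ih₂ => exact .seq (ih₁ hM.1) (ih₂ hM.2) hB
  | assign _ _ ih₁ ih₂ => exact .assign (ih₁ hM.1) (ih₂ hM.2)
  | deref _ ih => exact .deref (ih hM)
  | ifzero _ _ _ hB ih₁ ih₂ ih₃ => exact .ifzero (ih₁ hM.1) (ih₂ hM.2.1) (ih₃ hM.2.2) hB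
  | new hx _ hB ih => exact .new hx (ih ((Tm.randomFree_instAt_fvar _ _).2 hM)) hB
  | mkvar _ _ ih₁ ih₂ => exact .mkvar (ih₁ hM.1) (ih₂ hM.2)
  | random => exact hM.elim
  | _ =>
    rename_i ih₁ ih₂
    exact .while (ih₁ hM.1) (ih₂ hM.2)

theorem wf_append_singleton {x : ℕ} (h : Γ.WF) (hx : x ∉ Γ.ids) : TyCtx.WF (Γ ++ [(x, A)]) := by
  simp only [TyCtx.WF, TyCtx.ids] at *
  rw [List.map_append, List.nodup_append]
  refine ⟨h, by simp, ?_⟩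
  rintro a ha b hb rfl
  simp_all

/-- Identifiers need a nonempty context, and abstractions and `mkvar` terms have other types.
Observable results therefore contain neither markers nor `random`, and no substitution affects them.
-/
theorem closed_value {V : Tm ι} (h : HasType L [] V B) (hV : V.IsValue)
    (hB : B = .comm ∨ B = .nat) : V = .skip ∨ ∃ n, V = .num n := by
  generalize hΓ : ([] : TyCtx) = Γ at h
  induction h with
  | exchange _ hp ih => subst hΓ; exact ih hV hB (List.perm_nil.1 hp).symm
  | _ => cases hV <;> simp at hB hΓ ⊢

theorem look {r : ℕ} (T : List ℕ) (j : ℕ) :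
    HasType L [(r, .var)] (Tm.look r T j : Tm ι) .nat := by
  have hn (n : ℕ) : HasType L [(r, .var)] (.num n : Tm ι) .nat :=
    HasType.weakening (Γ := []) (.num n) (by simp [TyCtx.WF, TyCtx.ids])
  induction T generalizing j with
  | nil => exact hn 0
  | cons a T ih => exact .ifzero (.op _ (.deref (.var r _)) (hn j)) (hn a) (ih _) (by simp)

theorem gen {r : ℕ} (T : List ℕ) : HasType L [(r, .var)] (Tm.gen r T : Tm ι) .nat := by
  have hn (n : ℕ) : HasType L [(r, .var)] (.num n : Tm ι) .nat :=
    HasType.weakening (Γ := []) (.num n) (by simp [TyCtx.WF, TyCtx.ids])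
  exact .seq (.assign (.var r _) (.op _ (.deref (.var r _)) (hn 1))) (look T 1) (by simp)

end HasType

/-! ### Typing the generator in place of one occurrence of `random` -/

namespace HasType

theorem cons_ctx {Γ : TyCtx} {r : ℕ} {M : Tm ι} {L : Lang} {A B : Ty} (h : HasType L [(r, A)] M B)
    (hwf : TyCtx.WF (Γ ++ [(r, A)])) : HasType L (Γ ++ [(r, A)]) M B := by
  refine .exchange (h.weaken (Δ := Γ) ?_) List.perm_append_comm
  exact (List.perm_append_comm.map _).nodup_iff.1 hwf

/-- A single occurrence of `random` may be replaced by a counter with its own location. -/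
theorem subst_gen {Γ : TyCtx} {t : Tm ι} {B : Ty} (h : HasType .mkran Γ t B) :
    ∃ S : Finset ℕ, ∀ r ∉ S, ∀ ℓ : Tm ι, ℓ.occ r ≤ 1 → Tm.subst r .random ℓ = t → ∀ T,
      HasType .mkran (Γ ++ [(r, .var)]) (Tm.subst r (.gen r T) ℓ) B := by
  have aux : ∀ {Γ : TyCtx} {A : Ty}, Γ.WF → ∀ r ∉ Γ.ids.toFinset, TyCtx.WF (Γ ++ [(r, A)]) :=
    fun h r hr => wf_append_singleton h (by simpa using hr)
  have hrd : ∀ (P : Tm ι) (k : ℕ), Tm.instAt P k .random = .random := fun _ _ => rfl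
  -- Here `ℓ` is `t` with one occurrence of `random` marked by `r`. The set `S` collects identifiers
  -- named in the derivation, so that `r` clashes with no binder or context entry.
  induction h with
  | var x A =>
    refine ⟨{x}, fun r hr ℓ hocc hℓ T => ?_⟩
    cases ℓ <;> simp [Tm.subst] at hℓ
    split_ifs at hℓ with hy
    cases hℓ
    simp only [Tm.subst, hy, if_false]
    exact .weakening (.var x A)
      (aux (by simp [TyCtx.WF, TyCtx.ids]) r (by simpa [TyCtx.ids] using hr))
  | @lam Γ x A B M hx hM ih =>
    obtain ⟨S, ih⟩ := ih
    refine ⟨insert x S, fun r hr ℓ hocc hℓ T => ?_⟩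
    simp only [Finset.mem_insert, not_or] at hr
    cases ℓ <;> simp [Tm.subst] at hℓ
    case fvar => split_ifs at hℓ
    obtain ⟨rfl, rfl⟩ := hℓ
    rename_i ℓ
    have hxr : x ≠ r := Ne.symm hr.1
    refine .lam (x := x) ?_ ?_
    · rwa [Tm.mem_fv_subst (Tm.notMem_fv_gen hxr T) hxr,
        ← Tm.mem_fv_subst (Q := .random) (by simp [Tm.fv]) hxr]
    · have := ih r hr.2 (ℓ.inst (.fvar x)) (by rwa [Tm.inst, Tm.occ_instAt_fvar hxr])
        (Tm.subst_inst_fvar hrd hxr ℓ) T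
      rw [Tm.subst_inst_fvar (fun P k => Tm.instAt_gen P k T) hxr] at this
      refine .exchange this ?_
      simpa using List.Perm.append_left Γ (List.Perm.swap _ _ [])
  | @app Γ Δ A B M N hM hN hwf ih₁ ih₂ =>
    obtain ⟨S₁, ih₁⟩ := ih₁
    obtain ⟨S₂, ih₂⟩ := ih₂
    refine ⟨S₁ ∪ S₂ ∪ (TyCtx.ids (Γ ++ Δ)).toFinset, fun r hr ℓ hocc hℓ T => ?_⟩
    simp only [Finset.mem_union, not_or] at hr
    cases ℓ <;> simp [Tm.subst] at hℓ
    case fvar => split_ifs at hℓ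
    obtain ⟨rfl, rfl⟩ := hℓ
    rename_i ℓ₁ ℓ₂
    simp only [Tm.occ] at hocc
    have hwf' := aux (A := .var) hwf r hr.2
    simp only [Tm.subst]
    -- The contexts of function and argument are disjoint, so only one of them can receive `r`. As
    -- `r` marks at most one place, the other side is unchanged by the substitution and keeps its
    -- context.
    by_cases h₂ : ℓ₂.occ r = 0
    · rw [Tm.occ_eq_zero_iff] at h₂
      have key := ih₁ r hr.1.1 ℓ₁ (by omega) rfl T
      rw [Tm.subst_eq_self h₂] at hN ⊢
      have hp : (Γ ++ [(r, Ty.var)] ++ Δ).Perm (Γ ++ Δ ++ [(r, Ty.var)]) := by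
        simpa using List.Perm.append_left Γ (List.perm_append_comm (l₁ := [(r, Ty.var)]))
      exact .exchange (.app key hN ((hp.map _).nodup_iff.2 hwf')) hp
    · have h₁ : ℓ₁.occ r = 0 := by omega
      rw [Tm.occ_eq_zero_iff] at h₁
      have key := ih₂ r hr.1.2 ℓ₂ (by omega) rfl T
      rw [Tm.subst_eq_self h₁] at hM ⊢
      rw [List.append_assoc] at hwf' ⊢
      exact .app hM key hwf'
  | @weakening Γ x A B M hM hwf ih =>
    obtain ⟨S, ih⟩ := ih
    refine ⟨S ∪ (TyCtx.ids (Γ ++ [(x, A)])).toFinset, fun r hr ℓ hocc hℓ T => ?_⟩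
    simp only [Finset.mem_union, not_or] at hr
    have hp : (Γ ++ [(r, Ty.var)] ++ [(x, A)]).Perm (Γ ++ [(x, A)] ++ [(r, Ty.var)]) := by
      simpa using List.Perm.append_left Γ (List.Perm.swap _ _ [])
    exact .exchange (.weakening (ih r hr.1 ℓ hocc hℓ T)
      ((hp.map _).nodup_iff.2 (aux hwf r hr.2))) hp
  | exchange hM hp ih =>
    obtain ⟨S, ih⟩ := ih
    exact ⟨S, fun r hr ℓ hocc hℓ T => .exchange (ih r hr ℓ hocc hℓ T) (hp.append_right _)⟩
  | num n =>
    refine ⟨∅, fun r hr ℓ hocc hℓ T => ?_⟩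
    cases ℓ <;> simp [Tm.subst] at hℓ
    case fvar => split_ifs at hℓ
    subst hℓ
    exact weaken (Γ := []) (.num _) (by simp [TyCtx.WF, TyCtx.ids])
  | skip =>
    refine ⟨∅, fun r hr ℓ hocc hℓ T => ?_⟩
    cases ℓ <;> simp [Tm.subst] at hℓ
    case fvar => split_ifs at hℓ
    exact weaken (Γ := []) .skip (by simp [TyCtx.WF, TyCtx.ids])
  | @new Γ x B M hx hM hB ih =>
    obtain ⟨S, ih⟩ := ih
    refine ⟨insert x S, fun r hr ℓ hocc hℓ T => ?_⟩
    simp only [Finset.mem_insert, not_or] at hr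
    cases ℓ <;> simp [Tm.subst] at hℓ
    case fvar => split_ifs at hℓ
    subst hℓ
    rename_i ℓ
    have hxr : x ≠ r := Ne.symm hr.1
    refine .new (x := x) ?_ ?_ hB
    · rwa [Tm.mem_fv_subst (Tm.notMem_fv_gen hxr T) hxr,
        ← Tm.mem_fv_subst (Q := .random) (by simp [Tm.fv]) hxr]
    · have := ih r hr.2 (ℓ.inst (.fvar x)) (by rwa [Tm.inst, Tm.occ_instAt_fvar hxr])
        (Tm.subst_inst_fvar hrd hxr ℓ) T
      rw [Tm.subst_inst_fvar (fun P k => Tm.instAt_gen P k T) hxr] at this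
      refine .exchange this ?_
      simpa using List.Perm.append_left Γ (List.Perm.swap _ _ [])
  | @random Γ hL hwf =>
    refine ⟨Γ.ids.toFinset, fun r hr ℓ hocc hℓ T => ?_⟩
    have hwf' := aux (A := .var) hwf r hr
    cases ℓ <;> simp [Tm.subst] at hℓ
    -- Either this `random` is the marked one and becomes the generator, or it is another one and
    -- stays.
    case fvar y =>
      rw [Tm.subst, if_pos hℓ]
      exact cons_ctx (gen T) hwf'
    case random => exact .random rfl hwf'
  | ifzero hM hN₁ hN₂ hB ih₁ ih₂ ih₃ =>
    obtain ⟨S₁, ih₁⟩ := ih₁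
    obtain ⟨S₂, ih₂⟩ := ih₂
    obtain ⟨S₃, ih₃⟩ := ih₃
    refine ⟨S₁ ∪ S₂ ∪ S₃, fun r hr ℓ hocc hℓ T => ?_⟩
    simp only [Finset.mem_union, not_or] at hr
    cases ℓ <;> simp [Tm.subst] at hℓ
    case fvar => split_ifs at hℓ
    simp only [Tm.occ] at hocc
    exact .ifzero (ih₁ r hr.1.1 _ (by omega) hℓ.1 T) (ih₂ r hr.1.2 _ (by omega) hℓ.2.1 T)
      (ih₃ r hr.2 _ (by omega) hℓ.2.2 T) hB
  | deref hM ih =>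
    obtain ⟨S, ih⟩ := ih
    refine ⟨S, fun r hr ℓ hocc hℓ T => ?_⟩
    cases ℓ <;> simp [Tm.subst] at hℓ
    case fvar => split_ifs at hℓ
    rename_i ℓ
    exact .deref (ih r hr ℓ hocc hℓ T)
  | op o hM hN ih₁ ih₂ =>
    obtain ⟨S₁, ih₁⟩ := ih₁
    obtain ⟨S₂, ih₂⟩ := ih₂
    refine ⟨S₁ ∪ S₂, fun r hr ℓ hocc hℓ T => ?_⟩
    simp only [Finset.mem_union, not_or] at hr
    cases ℓ <;> simp [Tm.subst] at hℓ
    case fvar => split_ifs at hℓ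
    simp only [Tm.occ] at hocc
    exact .op _ (ih₁ r hr.1 _ (by omega) hℓ.2.1 T) (ih₂ r hr.2 _ (by omega) hℓ.2.2 T)
  | seq hM hN hB ih₁ ih₂ =>
    obtain ⟨S₁, ih₁⟩ := ih₁
    obtain ⟨S₂, ih₂⟩ := ih₂
    refine ⟨S₁ ∪ S₂, fun r hr ℓ hocc hℓ T => ?_⟩
    simp only [Finset.mem_union, not_or] at hr
    cases ℓ <;> simp [Tm.subst] at hℓ
    case fvar => split_ifs at hℓ
    simp only [Tm.occ] at hocc
    exact .seq (ih₁ r hr.1 _ (by omega) hℓ.1 T) (ih₂ r hr.2 _ (by omega) hℓ.2 T) hB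
  | _ hM hN ih₁ ih₂ =>
    obtain ⟨S₁, ih₁⟩ := ih₁
    obtain ⟨S₂, ih₂⟩ := ih₂
    refine ⟨S₁ ∪ S₂, fun r hr ℓ hocc hℓ T => ?_⟩
    simp only [Finset.mem_union, not_or] at hr
    cases ℓ <;> simp [Tm.subst] at hℓ
    case fvar => split_ifs at hℓ
    simp only [Tm.occ] at hocc
    have h₁ := ih₁ r hr.1 _ (by omega) hℓ.1 T
    have h₂ := ih₂ r hr.2 _ (by omega) hℓ.2 T
    first
    | exact .assign h₁ h₂
    | exact .while h₁ h₂
    | exact .mkvar h₁ h₂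

end HasType

/-! ### Values under substitution of a non-value -/

namespace Tm

variable {r : ℕ} {Q ℓ : Tm ι}

theorem not_isValue_random : ¬ (random : Tm ι).IsValue := by
  rintro ⟨⟩

theorem not_isValue_gen {T : List ℕ} : ¬ (gen r T : Tm ι).IsValue := by
  rintro ⟨⟩

/-- Neither `random` nor the generator is a value, so the head constructor of a value `subst r Q ℓ`
is already that of `ℓ`. This transfers the shape of a result from one substitution to the other. -/
theorem ne_of_subst_isValue (hQ : ¬ Q.IsValue) (h : (subst r Q ℓ).IsValue) : ℓ ≠ fvar r := by
  rintro rfl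
  simp [subst, hQ] at h

theorem isValue_subst (hQ : ¬ Q.IsValue) (h : (subst r Q ℓ).IsValue) (Q' : Tm ι) :
    (subst r Q' ℓ).IsValue := by
  have hr := ne_of_subst_isValue hQ h
  cases ℓ
  case fvar y =>
    have : y ≠ r := fun e => hr (e ▸ rfl)
    simp only [subst, this, if_false]
    exact .fvar y
  all_goals first | cases h; done | simp only [subst]; constructor

theorem subst_eq_num (hQ : ¬ Q.IsValue) {n : ℕ} (h : subst r Q ℓ = num n) : ℓ = num n := by
  have hr := ne_of_subst_isValue hQ (by rw [h]; exact .num n)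
  cases ℓ <;> simp_all [subst]

theorem subst_eq_skip (hQ : ¬ Q.IsValue) (h : subst r Q ℓ = skip) : ℓ = skip := by
  have hr := ne_of_subst_isValue hQ (by rw [h]; exact .skip)
  cases ℓ <;> simp_all [subst]

theorem subst_eq_fvar (hQ : ¬ Q.IsValue) {x : ℕ} (h : subst r Q ℓ = fvar x) :
    ℓ = fvar x ∧ x ≠ r := by
  have hr := ne_of_subst_isValue hQ (by rw [h]; exact .fvar x)
  cases ℓ <;> simp_all [subst]

theorem subst_eq_lam (hQ : ¬ Q.IsValue) {A : Ty} {M : Tm ι} (h : subst r Q ℓ = lam A M) :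
    ∃ ℓ', ℓ = lam A ℓ' ∧ subst r Q ℓ' = M := by
  have hr := ne_of_subst_isValue hQ (by rw [h]; exact .lam A M)
  cases ℓ <;> simp_all [subst]

theorem subst_eq_mkvar (hQ : ¬ Q.IsValue) {M N : Tm ι} (h : subst r Q ℓ = mkvar M N) :
    ∃ ℓ₁ ℓ₂, ℓ = mkvar ℓ₁ ℓ₂ ∧ subst r Q ℓ₁ = M ∧ subst r Q ℓ₂ = N := by
  have hr := ne_of_subst_isValue hQ (by rw [h]; exact .mkvar M N)
  cases ℓ <;> simp_all [subst]

end Tm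

/-! ### Replaying an evaluation from a table -/

namespace Eval

variable {opEval : ι → ℕ → ℕ → ℕ} {σ τ : Store} {t V : Tm ι} {r : ℕ}

/-- The stored number is at least the current label `j`, so truncated subtraction gives `0` exactly
when the two are equal; otherwise the search moves to the next entry and label. -/
theorem look_of_getElem? {T : List ℕ} {i j n : ℕ} (hT : T[i]? = some n)
    (hσ : σ.lookup r = some (j + i)) : Eval opEval σ (.look r T j) σ (.num n) := by
  induction T generalizing i j with
  | nil => simp at hT
  | cons a T ih =>
    have key : Eval opEval σ (.op .sub (.deref (.fvar r)) (.num j)) σ (.num (j + i - j)) :=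
      .op .sub (.deref (.value (.fvar r)) hσ) (.value (.num j))
    cases i with
    | zero =>
      have ha : a = n := by simpa using hT
      subst ha
      exact .ifzero_zero (by simpa using key) (.value (.num a))
    | succ i =>
      exact .ifzero_ne key (by omega) (ih (by simpa using hT) (by rw [hσ]; congr 1; omega))

/-- The counter is incremented before the lookup, so index `i` is sought with `i + 1` in store;
labels starting at `1` compensate for this. -/
theorem gen_of_getElem? {T : List ℕ} {i n : ℕ} (hT : T[i]? = some n) :
    Eval opEval (σ.insert r i) (.gen r T) (σ.insert r (i + 1)) (.num n) := by
  refine .seq (σ' := σ.insert r (i + 1)) ?_ (look_of_getElem? hT ?_)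
  · have : Eval opEval (σ.insert r i) (.op .add (.deref (.fvar r)) (.num 1)) (σ.insert r i)
        (.num (i + 1)) :=
      .op .add (.deref (.value (.fvar r)) (Finmap.lookup_insert σ)) (.value (.num 1))
    have := Eval.assign this (.value (.fvar r))
    rwa [Finmap.insert_insert] at this
  · rw [Finmap.lookup_insert, add_comm]

/-- Successive subevaluations read consecutive segments of the table. -/
theorem prefix_split {l₁ l₂ T : List ℕ} {i : ℕ} (h : l₁ ++ l₂ <+: T.drop i) :
    l₁ <+: T.drop i ∧ l₂ <+: T.drop (i + l₁.length) := by
  obtain ⟨s, hs⟩ := h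
  refine ⟨⟨l₂ ++ s, by simpa using hs⟩, ⟨s, ?_⟩⟩
  rw [← List.drop_drop, ← hs]
  simp

/-- The numbers returned by the occurrence of `random` marked `r` can be replayed from a table. -/
theorem subst_gen (h : Eval opEval σ t τ V) :
    ∃ S : Finset ℕ, ∀ r ∉ S, ∀ ℓ : Tm ι, Tm.subst r .random ℓ = t →
      ∃ (ns : List ℕ) (W : Tm ι), Tm.subst r .random W = V ∧ ∀ T i, ns <+: T.drop i →
        Eval opEval (σ.insert r i) (Tm.subst r (.gen r T) ℓ)
          (τ.insert r (i + ns.length)) (Tm.subst r (.gen r T) W) := by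
  have hrd : ∀ (P : Tm ι) (k : ℕ), Tm.instAt P k .random = .random := fun _ _ => rfl
  have hnv := Tm.not_isValue_random (ι := ι)
  -- The list `ns` is obtained before `T` and `i`, so the lists of subevaluations can be
  -- concatenated and the table fixed only at the end. The result is tracked as a marked term `W`,
  -- since under call-by-name it may still contain the marked occurrence.
  induction h with
  | value hV =>
    refine ⟨∅, fun r _ ℓ hℓ => ⟨[], ℓ, hℓ, fun T i _ => ?_⟩⟩
    subst hℓ
    exact .value (Tm.isValue_subst hnv hV _)
  | app _ _ ih₁ ih₂ =>
    obtain ⟨S₁, ih₁⟩ := ih₁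
    obtain ⟨S₂, ih₂⟩ := ih₂
    refine ⟨S₁ ∪ S₂, fun r hr ℓ hℓ => ?_⟩
    simp only [Finset.mem_union, not_or] at hr
    cases ℓ <;> simp [Tm.subst] at hℓ
    case fvar => split_ifs at hℓ
    rename_i ℓ₁ ℓ₂
    obtain ⟨ns₁, W₁, hW₁, ih₁⟩ := ih₁ r hr.1 ℓ₁ hℓ.1
    obtain ⟨B, rfl, hB⟩ := Tm.subst_eq_lam hnv hW₁
    -- Instantiation may duplicate the marker. All copies share the one counter, which is why no
    -- bound on `occ` is imposed on evaluations.
    obtain ⟨ns₂, W₂, hW₂, ih₂⟩ := ih₂ r hr.2 (B.inst ℓ₂) (by rw [Tm.subst_inst hrd, hB, hℓ.2])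
    refine ⟨ns₁ ++ ns₂, W₂, hW₂, fun T i hT => ?_⟩
    obtain ⟨hT₁, hT₂⟩ := prefix_split hT
    have e₂ := ih₂ T _ hT₂
    rw [Tm.subst_inst (fun P k => Tm.instAt_gen P k T), add_assoc, ← List.length_append] at e₂
    exact .app (ih₁ T i hT₁) e₂
  | op o _ _ ih₁ ih₂ =>
    obtain ⟨S₁, ih₁⟩ := ih₁
    obtain ⟨S₂, ih₂⟩ := ih₂
    refine ⟨S₁ ∪ S₂, fun r hr ℓ hℓ => ?_⟩
    simp only [Finset.mem_union, not_or] at hr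
    cases ℓ <;> simp [Tm.subst] at hℓ
    case fvar => split_ifs at hℓ
    obtain ⟨rfl, hℓ⟩ := hℓ
    obtain ⟨ns₁, W₁, hW₁, ih₁⟩ := ih₁ r hr.1 _ hℓ.1
    obtain ⟨ns₂, W₂, hW₂, ih₂⟩ := ih₂ r hr.2 _ hℓ.2
    obtain rfl := Tm.subst_eq_num hnv hW₁
    obtain rfl := Tm.subst_eq_num hnv hW₂
    refine ⟨ns₁ ++ ns₂, .num _, rfl, fun T i hT => ?_⟩
    obtain ⟨hT₁, hT₂⟩ := prefix_split hT
    have e₂ := ih₂ T _ hT₂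
    rw [add_assoc, ← List.length_append] at e₂
    exact .op _ (ih₁ T i hT₁) e₂
  | assign _ _ ih₁ ih₂ =>
    obtain ⟨S₁, ih₁⟩ := ih₁
    obtain ⟨S₂, ih₂⟩ := ih₂
    refine ⟨S₁ ∪ S₂, fun r hr ℓ hℓ => ?_⟩
    simp only [Finset.mem_union, not_or] at hr
    cases ℓ <;> simp [Tm.subst] at hℓ
    case fvar => split_ifs at hℓ
    obtain ⟨ns₁, W₁, hW₁, ih₁⟩ := ih₁ r hr.1 _ hℓ.2
    obtain ⟨ns₂, W₂, hW₂, ih₂⟩ := ih₂ r hr.2 _ hℓ.1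
    obtain rfl := Tm.subst_eq_num hnv hW₁
    obtain ⟨rfl, hx⟩ := Tm.subst_eq_fvar hnv hW₂
    refine ⟨ns₁ ++ ns₂, .skip, rfl, fun T i hT => ?_⟩
    obtain ⟨hT₁, hT₂⟩ := prefix_split hT
    have e₂ := ih₂ T _ hT₂
    rw [add_assoc, ← List.length_append] at e₂
    simp only [Tm.subst, hx, if_false] at e₂
    rw [Finmap.insert_insert_of_ne _ hx]
    exact .assign (ih₁ T i hT₁) e₂
  | deref _ hn ih =>
    obtain ⟨S, ih⟩ := ih
    refine ⟨S, fun r hr ℓ hℓ => ?_⟩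
    cases ℓ <;> simp [Tm.subst] at hℓ
    case fvar => split_ifs at hℓ
    obtain ⟨ns, W, hW, ih⟩ := ih r hr _ hℓ
    obtain ⟨rfl, hx⟩ := Tm.subst_eq_fvar hnv hW
    refine ⟨ns, .num _, rfl, fun T i hT => ?_⟩
    have e := ih T i hT
    simp only [Tm.subst, hx, if_false] at e
    exact .deref e (by rwa [Finmap.lookup_insert_of_ne _ hx])
  | seq _ _ ih₁ ih₂ =>
    obtain ⟨S₁, ih₁⟩ := ih₁
    obtain ⟨S₂, ih₂⟩ := ih₂
    refine ⟨S₁ ∪ S₂, fun r hr ℓ hℓ => ?_⟩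
    simp only [Finset.mem_union, not_or] at hr
    cases ℓ <;> simp [Tm.subst] at hℓ
    case fvar => split_ifs at hℓ
    obtain ⟨ns₁, W₁, hW₁, ih₁⟩ := ih₁ r hr.1 _ hℓ.1
    obtain ⟨ns₂, W₂, hW₂, ih₂⟩ := ih₂ r hr.2 _ hℓ.2
    obtain rfl := Tm.subst_eq_skip hnv hW₁
    refine ⟨ns₁ ++ ns₂, W₂, hW₂, fun T i hT => ?_⟩
    obtain ⟨hT₁, hT₂⟩ := prefix_split hT
    have e₂ := ih₂ T _ hT₂
    rw [add_assoc, ← List.length_append] at e₂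
    exact .seq (ih₁ T i hT₁) e₂
  | while_exit _ hn ih =>
    obtain ⟨S, ih⟩ := ih
    refine ⟨S, fun r hr ℓ hℓ => ?_⟩
    cases ℓ <;> simp [Tm.subst] at hℓ
    case fvar => split_ifs at hℓ
    obtain ⟨ns, W, hW, ih⟩ := ih r hr _ hℓ.1
    obtain rfl := Tm.subst_eq_num hnv hW
    exact ⟨ns, .skip, rfl, fun T i hT => .while_exit (ih T i hT) hn⟩
  | while_loop _ _ _ ih₁ ih₂ ih₃ =>
    obtain ⟨S₁, ih₁⟩ := ih₁
    obtain ⟨S₂, ih₂⟩ := ih₂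
    obtain ⟨S₃, ih₃⟩ := ih₃
    refine ⟨S₁ ∪ S₂ ∪ S₃, fun r hr ℓ hℓ => ?_⟩
    simp only [Finset.mem_union, not_or] at hr
    -- The loop is evaluated again as a whole, so its hypothesis is applied to `ℓ` before `ℓ` is
    -- decomposed.
    obtain ⟨ns₃, W₃, hW₃, ih₃⟩ := ih₃ r hr.2 _ hℓ
    cases ℓ <;> simp [Tm.subst] at hℓ
    case fvar => split_ifs at hℓ
    obtain ⟨ns₁, W₁, hW₁, ih₁⟩ := ih₁ r hr.1.1 _ hℓ.1
    obtain ⟨ns₂, W₂, hW₂, ih₂⟩ := ih₂ r hr.1.2 _ hℓ.2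
    obtain rfl := Tm.subst_eq_num hnv hW₁
    obtain rfl := Tm.subst_eq_skip hnv hW₂
    obtain rfl := Tm.subst_eq_skip hnv hW₃
    refine ⟨ns₁ ++ (ns₂ ++ ns₃), .skip, rfl, fun T i hT => ?_⟩
    obtain ⟨hT₁, hT₂⟩ := prefix_split hT
    obtain ⟨hT₂, hT₃⟩ := prefix_split hT₂
    have e₃ := ih₃ T _ hT₃
    have hl : i + ns₁.length + ns₂.length + ns₃.length = i + (ns₁ ++ (ns₂ ++ ns₃)).length := by
      simp [add_assoc]
    rw [hl] at e₃
    exact .while_loop (ih₁ T i hT₁) (ih₂ T _ hT₂) e₃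
  | ifzero_zero _ _ ih₁ ih₂ =>
    obtain ⟨S₁, ih₁⟩ := ih₁
    obtain ⟨S₂, ih₂⟩ := ih₂
    refine ⟨S₁ ∪ S₂, fun r hr ℓ hℓ => ?_⟩
    simp only [Finset.mem_union, not_or] at hr
    cases ℓ <;> simp [Tm.subst] at hℓ
    case fvar => split_ifs at hℓ
    obtain ⟨ns₁, W₁, hW₁, ih₁⟩ := ih₁ r hr.1 _ hℓ.1
    obtain ⟨ns₂, W₂, hW₂, ih₂⟩ := ih₂ r hr.2 _ hℓ.2.1
    obtain rfl := Tm.subst_eq_num hnv hW₁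
    refine ⟨ns₁ ++ ns₂, W₂, hW₂, fun T i hT => ?_⟩
    obtain ⟨hT₁, hT₂⟩ := prefix_split hT
    have e₂ := ih₂ T _ hT₂
    rw [add_assoc, ← List.length_append] at e₂
    exact .ifzero_zero (ih₁ T i hT₁) e₂
  | ifzero_ne _ hn _ ih₁ ih₂ =>
    obtain ⟨S₁, ih₁⟩ := ih₁
    obtain ⟨S₂, ih₂⟩ := ih₂
    refine ⟨S₁ ∪ S₂, fun r hr ℓ hℓ => ?_⟩
    simp only [Finset.mem_union, not_or] at hr
    cases ℓ <;> simp [Tm.subst] at hℓ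
    case fvar => split_ifs at hℓ
    obtain ⟨ns₁, W₁, hW₁, ih₁⟩ := ih₁ r hr.1 _ hℓ.1
    obtain ⟨ns₂, W₂, hW₂, ih₂⟩ := ih₂ r hr.2 _ hℓ.2.2
    obtain rfl := Tm.subst_eq_num hnv hW₁
    refine ⟨ns₁ ++ ns₂, W₂, hW₂, fun T i hT => ?_⟩
    obtain ⟨hT₁, hT₂⟩ := prefix_split hT
    have e₂ := ih₂ T _ hT₂
    rw [add_assoc, ← List.length_append] at e₂
    exact .ifzero_ne (ih₁ T i hT₁) hn e₂
  | @new σ σ' M V x n hM hV hσ hσ' _ ih =>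
    obtain ⟨S, ih⟩ := ih
    refine ⟨insert x S, fun r hr ℓ hℓ => ?_⟩
    simp only [Finset.mem_insert, not_or] at hr
    cases ℓ <;> simp [Tm.subst] at hℓ
    case fvar => split_ifs at hℓ
    rename_i ℓ
    have hxr : x ≠ r := Ne.symm hr.1
    subst hℓ
    obtain ⟨ns, W, hW, key⟩ := ih r hr.2 (ℓ.inst (.fvar x)) (Tm.subst_inst_fvar hrd hxr ℓ)
    subst hW
    refine ⟨ns, W, rfl, fun T i hT => ?_⟩
    have e := key T i hT
    rw [Tm.subst_inst_fvar (fun P k => Tm.instAt_gen P k T) hxr,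
      Finmap.insert_insert_of_ne _ hxr, Finmap.insert_insert_of_ne _ hxr] at e
    have hrf : x ∉ (Tm.random : Tm ι).fv := by simp [Tm.fv]
    refine .new ?_ ?_ ?_ ?_ e
    · rwa [Tm.mem_fv_subst (Tm.notMem_fv_gen hxr T) hxr, ← Tm.mem_fv_subst hrf hxr]
    · rwa [Tm.mem_fv_subst (Tm.notMem_fv_gen hxr T) hxr, ← Tm.mem_fv_subst hrf hxr]
    · simp [Finmap.mem_insert, hxr, hσ]
    · simp [Finmap.mem_insert, hxr, hσ']
  | assign_mkvar _ _ _ ih₁ ih₂ ih₃ =>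
    obtain ⟨S₁, ih₁⟩ := ih₁
    obtain ⟨S₂, ih₂⟩ := ih₂
    obtain ⟨S₃, ih₃⟩ := ih₃
    refine ⟨S₁ ∪ S₂ ∪ S₃, fun r hr ℓ hℓ => ?_⟩
    simp only [Finset.mem_union, not_or] at hr
    cases ℓ <;> simp [Tm.subst] at hℓ
    case fvar => split_ifs at hℓ
    obtain ⟨ns₁, W₁, hW₁, ih₁⟩ := ih₁ r hr.1.1 _ hℓ.2
    obtain ⟨ns₂, W₂, hW₂, ih₂⟩ := ih₂ r hr.1.2 _ hℓ.1
    obtain rfl := Tm.subst_eq_num hnv hW₁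
    obtain ⟨P₁, P₂, rfl, hP₁, hP₂⟩ := Tm.subst_eq_mkvar hnv hW₂
    obtain ⟨ns₃, W₃, hW₃, ih₃⟩ := ih₃ r hr.2 (.app P₁ (.num _)) (by rw [Tm.subst, hP₁, Tm.subst])
    refine ⟨ns₁ ++ (ns₂ ++ ns₃), W₃, hW₃, fun T i hT => ?_⟩
    obtain ⟨hT₁, hT₂⟩ := prefix_split hT
    obtain ⟨hT₂, hT₃⟩ := prefix_split hT₂
    have e₃ := ih₃ T _ hT₃
    have hl : i + ns₁.length + ns₂.length + ns₃.length = i + (ns₁ ++ (ns₂ ++ ns₃)).length := by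
      simp [add_assoc]
    rw [hl] at e₃
    exact .assign_mkvar (ih₁ T i hT₁) (ih₂ T _ hT₂) e₃
  | deref_mkvar _ _ ih₁ ih₂ =>
    obtain ⟨S₁, ih₁⟩ := ih₁
    obtain ⟨S₂, ih₂⟩ := ih₂
    refine ⟨S₁ ∪ S₂, fun r hr ℓ hℓ => ?_⟩
    simp only [Finset.mem_union, not_or] at hr
    cases ℓ <;> simp [Tm.subst] at hℓ
    case fvar => split_ifs at hℓ
    obtain ⟨ns₁, W₁, hW₁, ih₁⟩ := ih₁ r hr.1 _ hℓ
    obtain ⟨P₁, P₂, rfl, hP₁, hP₂⟩ := Tm.subst_eq_mkvar hnv hW₁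
    obtain ⟨ns₂, W₂, hW₂, ih₂⟩ := ih₂ r hr.2 P₂ hP₂
    refine ⟨ns₁ ++ ns₂, W₂, hW₂, fun T i hT => ?_⟩
    obtain ⟨hT₁, hT₂⟩ := prefix_split hT
    have e₂ := ih₂ T _ hT₂
    rw [add_assoc, ← List.length_append] at e₂
    exact .deref_mkvar (ih₁ T i hT₁) e₂
  | random n =>
    refine ⟨∅, fun r hr ℓ hℓ => ?_⟩
    -- A marked occurrence consumes one table entry; an unmarked one remains `random` and consumes
    -- none.
    by_cases h : ℓ = .fvar r
    · subst h
      refine ⟨[n], .num n, rfl, fun T i hT => ?_⟩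
      simp only [Tm.subst, if_true]
      refine gen_of_getElem? ?_
      obtain ⟨s, hs⟩ := hT
      rw [← List.head?_drop, ← hs]
      rfl
    · cases ℓ <;> simp [Tm.subst] at hℓ
      case fvar => exact absurd (hℓ ▸ rfl) h
      exact ⟨[], .num n, rfl, fun T i _ => .random n⟩

/-! ### From the generator back to `random` -/

theorem of_op_deref {o : BinOp ι} {j : ℕ}
    (h : Eval opEval σ (.op o (.deref (.fvar r)) (.num j)) τ V) : τ = σ := by
  cases h with
  | value hV => cases hV
  | op _ h₁ h₂ =>
    cases h₂
    cases h₁ with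
    | deref h₁ _ => cases h₁; rfl
    | deref_mkvar h₁ _ => cases h₁

theorem of_look {T : List ℕ} {j : ℕ} (h : Eval opEval σ (.look r T j) τ V) :
    τ = σ ∧ ∃ n, V = .num n := by
  induction T generalizing j with
  | nil => cases h; exact ⟨rfl, _, rfl⟩
  | cons a T ih =>
    cases h with
    | value hV => cases hV
    | ifzero_zero h₁ h₂ =>
      obtain rfl := of_op_deref h₁
      cases h₂
      exact ⟨rfl, _, rfl⟩
    | ifzero_ne h₁ _ h₂ =>
      obtain rfl := of_op_deref h₁
      exact ih h₂

/-- Which numeral comes back is irrelevant, even the default `0` past the end of the table: `random`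
can return it too. What matters is that the store changes only at `r`. -/
theorem of_gen {T : List ℕ} (h : Eval opEval σ (.gen r T) τ V) :
    ∃ m n, τ = σ.insert r m ∧ V = .num n := by
  cases h with
  | value hV => cases hV
  | seq g₁ g₂ =>
    obtain ⟨rfl, n, rfl⟩ := of_look g₂
    cases g₁ with
    | assign h₁ h₂ =>
      cases h₂
      obtain rfl := of_op_deref h₁
      exact ⟨_, n, rfl, rfl⟩
    | assign_mkvar _ h₂ _ => cases h₂

end Eval

theorem erase_insert_self (σ : Store) (r n : ℕ) : (σ.insert r n).erase r = σ.erase r := by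
  refine Finmap.ext_lookup fun x => ?_
  by_cases h : x = r
  · subst h; simp
  · simp [h]

theorem erase_insert_of_ne (σ : Store) {r x : ℕ} (n : ℕ) (h : x ≠ r) :
    (σ.insert x n).erase r = (σ.erase r).insert x n := by
  refine Finmap.ext_lookup fun y => ?_
  by_cases h₁ : y = r
  · subst h₁; simp [h.symm]
  · by_cases h₂ : y = x
    · subst h₂; simp [h]
    · simp [h₁, h₂]

namespace Eval

variable {opEval : ι → ℕ → ℕ → ℕ} {σ τ : Store} {t V : Tm ι}

/-- Any evaluation with a table in place of an occurrence of `random` is a possible evaluation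
with `random`. -/
theorem subst_random {r : ℕ} {T : List ℕ} (h : Eval opEval σ t τ V) :
    ∀ ℓ : Tm ι, Tm.subst r (.gen r T) ℓ = t → r ∈ σ →
      r ∈ τ ∧ ∃ W : Tm ι, Tm.subst r (.gen r T) W = V ∧
        Eval opEval (σ.erase r) (Tm.subst r .random ℓ) (τ.erase r) (Tm.subst r .random W) := by
  have hrd : ∀ (P : Tm ι) (k : ℕ), Tm.instAt P k .random = .random := fun _ _ => rfl
  have hgen : ∀ (P : Tm ι) (k : ℕ), Tm.instAt P k (.gen r T) = .gen r T :=
    fun P k => Tm.instAt_gen P k T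
  have hnv := Tm.not_isValue_gen (ι := ι) (r := r) (T := T)
  induction h with
  | value hV =>
    rintro ℓ rfl hr
    exact ⟨hr, ℓ, rfl, .value (Tm.isValue_subst hnv hV _)⟩
  | app _ _ ih₁ ih₂ =>
    intro ℓ hℓ hr
    cases ℓ <;> simp [Tm.subst] at hℓ
    case fvar => split_ifs at hℓ; cases hℓ
    rename_i ℓ₁ ℓ₂
    obtain ⟨hr, W₁, hW₁, e₁⟩ := ih₁ ℓ₁ hℓ.1 hr
    obtain ⟨B, rfl, hB⟩ := Tm.subst_eq_lam hnv hW₁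
    obtain ⟨hr, W₂, hW₂, e₂⟩ := ih₂ (B.inst ℓ₂) (by rw [Tm.subst_inst hgen, hB, hℓ.2]) hr
    rw [Tm.subst_inst hrd] at e₂
    exact ⟨hr, W₂, hW₂, .app e₁ e₂⟩
  | op o _ _ ih₁ ih₂ =>
    intro ℓ hℓ hr
    cases ℓ <;> simp [Tm.subst] at hℓ
    case fvar => split_ifs at hℓ; cases hℓ
    obtain ⟨rfl, hℓ⟩ := hℓ
    obtain ⟨hr, W₁, hW₁, e₁⟩ := ih₁ _ hℓ.1 hr
    obtain ⟨hr, W₂, hW₂, e₂⟩ := ih₂ _ hℓ.2 hr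
    obtain rfl := Tm.subst_eq_num hnv hW₁
    obtain rfl := Tm.subst_eq_num hnv hW₂
    exact ⟨hr, .num _, rfl, .op _ e₁ e₂⟩
  | assign _ _ ih₁ ih₂ =>
    intro ℓ hℓ hr
    cases ℓ <;> simp [Tm.subst] at hℓ
    case fvar => split_ifs at hℓ; cases hℓ
    obtain ⟨hr, W₁, hW₁, e₁⟩ := ih₁ _ hℓ.2 hr
    obtain ⟨hr, W₂, hW₂, e₂⟩ := ih₂ _ hℓ.1 hr
    obtain rfl := Tm.subst_eq_num hnv hW₁
    obtain ⟨rfl, hx⟩ := Tm.subst_eq_fvar hnv hW₂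
    simp only [Tm.subst, hx, if_false] at e₂
    refine ⟨Finmap.mem_insert.2 (.inr hr), .skip, rfl, ?_⟩
    rw [erase_insert_of_ne _ _ hx]
    exact .assign e₁ e₂
  | deref _ hn ih =>
    intro ℓ hℓ hr
    cases ℓ <;> simp [Tm.subst] at hℓ
    case fvar => split_ifs at hℓ; cases hℓ
    obtain ⟨hr, W, hW, e⟩ := ih _ hℓ hr
    obtain ⟨rfl, hx⟩ := Tm.subst_eq_fvar hnv hW
    simp only [Tm.subst, hx, if_false] at e
    exact ⟨hr, .num _, rfl, .deref e (by rwa [Finmap.lookup_erase_ne hx])⟩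
  | @seq σ σ' σ'' M N V h₁ h₂ ih₁ ih₂ =>
    intro ℓ hℓ hr
    -- The generator is itself a sequential composition, so this is the only case where the marker
    -- can be met. Its whole evaluation collapses to one step of `random`, and erasing `r` hides the
    -- increment.
    by_cases hf : ℓ = .fvar r
    · subst hf
      simp only [Tm.subst, if_true] at hℓ ⊢
      obtain ⟨m, n, rfl, rfl⟩ := of_gen (hℓ ▸ h₁.seq h₂)
      refine ⟨Finmap.mem_insert.2 (.inl rfl), .num n, rfl, ?_⟩
      rw [erase_insert_self]
      exact .random n
    cases ℓ <;> simp [Tm.subst] at hℓ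
    case fvar y =>
      have hy : y ≠ r := fun e => hf (e ▸ rfl)
      simp [hy] at hℓ
    obtain ⟨hr, W₁, hW₁, e₁⟩ := ih₁ _ hℓ.1 hr
    obtain ⟨hr, W₂, hW₂, e₂⟩ := ih₂ _ hℓ.2 hr
    obtain rfl := Tm.subst_eq_skip hnv hW₁
    exact ⟨hr, W₂, hW₂, .seq e₁ e₂⟩
  | while_exit _ hn ih =>
    intro ℓ hℓ hr
    cases ℓ <;> simp [Tm.subst] at hℓ
    case fvar => split_ifs at hℓ; cases hℓ
    obtain ⟨hr, W, hW, e⟩ := ih _ hℓ.1 hr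
    obtain rfl := Tm.subst_eq_num hnv hW
    exact ⟨hr, .skip, rfl, .while_exit e hn⟩
  | while_loop _ _ _ ih₁ ih₂ ih₃ =>
    intro ℓ hℓ hr
    replace ih₃ := ih₃ ℓ hℓ
    cases ℓ <;> simp [Tm.subst] at hℓ
    case fvar => split_ifs at hℓ; cases hℓ
    obtain ⟨hr, W₁, hW₁, e₁⟩ := ih₁ _ hℓ.1 hr
    obtain ⟨hr, W₂, hW₂, e₂⟩ := ih₂ _ hℓ.2 hr
    obtain ⟨hr, W₃, hW₃, e₃⟩ := ih₃ hr
    obtain rfl := Tm.subst_eq_num hnv hW₁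
    obtain rfl := Tm.subst_eq_skip hnv hW₂
    obtain rfl := Tm.subst_eq_skip hnv hW₃
    exact ⟨hr, .skip, rfl, .while_loop e₁ e₂ e₃⟩
  | ifzero_zero _ _ ih₁ ih₂ =>
    intro ℓ hℓ hr
    cases ℓ <;> simp [Tm.subst] at hℓ
    case fvar => split_ifs at hℓ; cases hℓ
    obtain ⟨hr, W₁, hW₁, e₁⟩ := ih₁ _ hℓ.1 hr
    obtain ⟨hr, W₂, hW₂, e₂⟩ := ih₂ _ hℓ.2.1 hr
    obtain rfl := Tm.subst_eq_num hnv hW₁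
    exact ⟨hr, W₂, hW₂, .ifzero_zero e₁ e₂⟩
  | ifzero_ne _ hn _ ih₁ ih₂ =>
    intro ℓ hℓ hr
    cases ℓ <;> simp [Tm.subst] at hℓ
    case fvar => split_ifs at hℓ; cases hℓ
    obtain ⟨hr, W₁, hW₁, e₁⟩ := ih₁ _ hℓ.1 hr
    obtain ⟨hr, W₂, hW₂, e₂⟩ := ih₂ _ hℓ.2.2 hr
    obtain rfl := Tm.subst_eq_num hnv hW₁
    exact ⟨hr, W₂, hW₂, .ifzero_ne e₁ hn e₂⟩
  | @new σ σ' M V x n hM hV hσ hσ' _ ih =>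
    intro ℓ hℓ hr
    cases ℓ <;> simp [Tm.subst] at hℓ
    case fvar => split_ifs at hℓ; cases hℓ
    rename_i ℓ
    -- The invariant that `r` is in the store keeps the location chosen by `new` away from `r`.
    have hxr : x ≠ r := by rintro rfl; exact hσ hr
    subst hℓ
    obtain ⟨hr', W, hW, e⟩ := ih (ℓ.inst (.fvar x)) (Tm.subst_inst_fvar hgen hxr ℓ)
      (Finmap.mem_insert.2 (.inr hr))
    subst hW
    rw [Tm.subst_inst_fvar hrd hxr, erase_insert_of_ne _ _ hxr, erase_insert_of_ne _ _ hxr] at e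
    have hrf : x ∉ (Tm.random : Tm ι).fv := by simp [Tm.fv]
    refine ⟨(Finmap.mem_insert.1 hr').resolve_left hxr.symm, W, rfl, .new ?_ ?_ ?_ ?_ e⟩
    · rwa [Tm.mem_fv_subst hrf hxr, ← Tm.mem_fv_subst (Tm.notMem_fv_gen hxr T) hxr]
    · rwa [Tm.mem_fv_subst hrf hxr, ← Tm.mem_fv_subst (Tm.notMem_fv_gen hxr T) hxr]
    · simp [Finmap.mem_erase, hσ]
    · simp [Finmap.mem_erase, hσ']
  | assign_mkvar _ _ _ ih₁ ih₂ ih₃ =>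
    intro ℓ hℓ hr
    cases ℓ <;> simp [Tm.subst] at hℓ
    case fvar => split_ifs at hℓ; cases hℓ
    obtain ⟨hr, W₁, hW₁, e₁⟩ := ih₁ _ hℓ.2 hr
    obtain ⟨hr, W₂, hW₂, e₂⟩ := ih₂ _ hℓ.1 hr
    obtain rfl := Tm.subst_eq_num hnv hW₁
    obtain ⟨P₁, P₂, rfl, hP₁, hP₂⟩ := Tm.subst_eq_mkvar hnv hW₂
    obtain ⟨hr, W₃, hW₃, e₃⟩ := ih₃ (.app P₁ (.num _)) (by rw [Tm.subst, hP₁, Tm.subst]) hr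
    exact ⟨hr, W₃, hW₃, .assign_mkvar e₁ e₂ e₃⟩
  | deref_mkvar _ _ ih₁ ih₂ =>
    intro ℓ hℓ hr
    cases ℓ <;> simp [Tm.subst] at hℓ
    case fvar => split_ifs at hℓ; cases hℓ
    obtain ⟨hr, W₁, hW₁, e₁⟩ := ih₁ _ hℓ hr
    obtain ⟨P₁, P₂, rfl, hP₁, hP₂⟩ := Tm.subst_eq_mkvar hnv hW₁
    obtain ⟨hr, W₂, hW₂, e₂⟩ := ih₂ P₂ hP₂ hr
    exact ⟨hr, W₂, hW₂, .deref_mkvar e₁ e₂⟩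
  | random n =>
    intro ℓ hℓ hr
    cases ℓ <;> simp [Tm.subst] at hℓ
    case fvar => split_ifs at hℓ; cases hℓ
    exact ⟨hr, .num n, rfl, .random n⟩

end Eval

/-! ### Isolating one occurrence of `random` in a context -/

namespace Context

/-- The identifiers of a context, bound or free. -/
def names : Context ι → Finset ℕ
  | .hole => ∅
  | .id x => {x}
  | .num _ => ∅
  | .op _ C D => C.names ∪ D.names
  | .skip => ∅
  | .seq C D => C.names ∪ D.names
  | .assign C D => C.names ∪ D.names
  | .deref C => C.names
  | .while C D => C.names ∪ D.names
  | .ifzero C D₁ D₂ => C.names ∪ D₁.names ∪ D₂.names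
  | .lam x _ C => insert x C.names
  | .app C D => C.names ∪ D.names
  | .new x C => insert x C.names
  | .mkvar C D => C.names ∪ D.names
  | .random => ∅

/-- The number of occurrences of `random` in a context. -/
def randoms : Context ι → ℕ
  | .hole => 0
  | .id _ => 0
  | .num _ => 0
  | .op _ C D => C.randoms + D.randoms
  | .skip => 0
  | .seq C D => C.randoms + D.randoms
  | .assign C D => C.randoms + D.randoms
  | .deref C => C.randoms
  | .while C D => C.randoms + D.randoms
  | .ifzero C D₁ D₂ => C.randoms + D₁.randoms + D₂.randoms
  | .lam _ _ C => C.randoms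
  | .app C D => C.randoms + D.randoms
  | .new _ C => C.randoms
  | .mkvar C D => C.randoms + D.randoms
  | .random => 1

/-- The term `Tm.look r T j` as a context without holes. -/
def look (r : ℕ) : List ℕ → ℕ → Context ι
  | [], _ => .num 0
  | a :: T, j => .ifzero (.op .sub (.deref (.id r)) (.num j)) (.num a) (look r T (j + 1))

/-- The term `Tm.gen r T` as a context without holes. -/
def gen (r : ℕ) (T : List ℕ) : Context ι :=
  .seq (.assign (.id r) (.op .add (.deref (.id r)) (.num 1))) (look r T 1)

theorem fill_look (M : Tm ι) (r : ℕ) (T : List ℕ) (j : ℕ) :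
    (look r T j).fill M = Tm.look r T j := by
  induction T generalizing j <;> simp_all [look, fill, Tm.look]

theorem fill_gen (M : Tm ι) (r : ℕ) (T : List ℕ) : (gen r T).fill M = Tm.gen r T := by
  simp [gen, fill, Tm.gen, fill_look]

theorem randoms_look (r : ℕ) (T : List ℕ) (j : ℕ) : (look r T j : Context ι).randoms = 0 := by
  induction T generalizing j <;> simp_all [look, randoms]

theorem randoms_gen (r : ℕ) (T : List ℕ) : (gen r T : Context ι).randoms = 0 := by
  simp [gen, randoms, randoms_look]

theorem fv_fill (C : Context ι) (M : Tm ι) : (C.fill M).fv ⊆ C.names ∪ M.fv := by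
  intro x
  induction C <;> simp_all [fill, names, Tm.fv, Tm.namedLam, Tm.namedNew, Tm.fv_closeAt]
  all_goals tauto

theorem randomFree_fill {C : Context ι} {M : Tm ι} (hC : C.randoms = 0) (hM : M.RandomFree) :
    (C.fill M).RandomFree := by
  induction C <;>
    simp_all [fill, randoms, Tm.RandomFree, Tm.namedLam, Tm.namedNew, Tm.randomFree_closeAt]

/-- `F` plugs a context without holes for one particular occurrence of `random` in `C`. -/
structure IsFocus (C : Context ι) (F : Context ι → Context ι) : Prop where
  random : F .random = C
  randoms : ∀ Q, (F Q).randoms + 1 = C.randoms + Q.randoms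
  occ : ∀ r ∉ C.names, ∀ M : Tm ι, r ∉ M.fv → ((F (.id r)).fill M).occ r = 1
  fill : ∀ r ∉ C.names, ∀ M : Tm ι, r ∉ M.fv → ∀ Q,
    (∀ x k, x ≠ r → Tm.closeAt x k (Context.fill M Q) = Context.fill M Q) →
    (F Q).fill M = Tm.subst r (Q.fill M) ((F (.id r)).fill M)

theorem notMem_fv_fill {C : Context ι} {M : Tm ι} {r : ℕ} (hC : r ∉ C.names) (hM : r ∉ M.fv) :
    r ∉ (C.fill M).fv := fun h => by
  have := C.fv_fill M h
  simp_all

/-- The leftmost occurrence is taken. Plugging is textual and could capture identifiers of `Q`, but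
the closing condition on `Q` makes it insensitive to every binder other than `r`, and `r` is not
bound in `C`; so plugging agrees with substitution for `r`. -/
theorem exists_isFocus (C : Context ι) (hC : C.randoms ≠ 0) : ∃ F, IsFocus C F := by
  have hocc : ∀ (D : Context ι) (r) (M : Tm ι), r ∉ D.names → r ∉ M.fv →
      (D.fill M).occ r = 0 := fun D r M h h' =>
    (Tm.occ_eq_zero_iff _).2 (notMem_fv_fill h h')
  have hsub : ∀ (D : Context ι) (r) (M Q : Tm ι), r ∉ D.names → r ∉ M.fv →
      Tm.subst r Q (D.fill M) = D.fill M := fun D r M Q h h' =>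
    Tm.subst_eq_self (notMem_fv_fill h h')
  -- One argument for all binary formers: descend to the left if there is a `random` there,
  -- otherwise to the right.
  have bin : ∀ (K : Context ι → Context ι → Context ι) (k : Tm ι → Tm ι → Tm ι),
      (∀ C D, (K C D).randoms = C.randoms + D.randoms) →
      (∀ C D, (K C D).names = C.names ∪ D.names) →
      (∀ C D M, (K C D).fill M = k (C.fill M) (D.fill M)) →
      (∀ r M N, (k M N).occ r = M.occ r + N.occ r) →
      (∀ r Q M N, Tm.subst r Q (k M N) = k (Tm.subst r Q M) (Tm.subst r Q N)) →
      ∀ C D, (C.randoms ≠ 0 → ∃ F, IsFocus C F) → (D.randoms ≠ 0 → ∃ F, IsFocus D F) →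
      (K C D).randoms ≠ 0 → ∃ F, IsFocus (K C D) F := by
    intro K k hr hn hf ho hs C D ihC ihD h
    rw [hr] at h
    by_cases hC : C.randoms = 0
    · obtain ⟨F, hF⟩ := ihD (by omega)
      refine ⟨fun Q => K C (F Q), by rw [hF.random], fun Q => ?_, fun r h M hM => ?_,
        fun r h M hM Q hQ => ?_⟩
      · have := hF.randoms Q
        rw [hr, hr]; omega
      · rw [hn, Finset.notMem_union] at h
        rw [hf, ho, hF.occ r h.2 M hM, hocc C r M h.1 hM]
      · rw [hn, Finset.notMem_union] at h
        rw [hf, hf, hs, hF.fill r h.2 M hM Q hQ, hsub C r M _ h.1 hM]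
    · obtain ⟨F, hF⟩ := ihC hC
      refine ⟨fun Q => K (F Q) D, by rw [hF.random], fun Q => ?_, fun r h M hM => ?_,
        fun r h M hM Q hQ => ?_⟩
      · have := hF.randoms Q
        rw [hr, hr]; omega
      · rw [hn, Finset.notMem_union] at h
        rw [hf, ho, hF.occ r h.1 M hM, hocc D r M h.2 hM]
      · rw [hn, Finset.notMem_union] at h
        rw [hf, hf, hs, hF.fill r h.1 M hM Q hQ, hsub D r M _ h.2 hM]
  induction C with
  | hole | id | num | skip => exact absurd rfl hC
  | random =>
    refine ⟨fun Q => Q, rfl, fun Q => ?_, fun r _ M _ => ?_, fun r _ M _ Q _ => ?_⟩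
    · simp [Context.randoms, add_comm]
    · simp [Context.fill, Tm.occ]
    · simp [Context.fill, Tm.subst]
  | op o C D ihC ihD =>
    exact bin (.op o) (.op o) (fun _ _ => rfl) (fun _ _ => rfl) (fun _ _ _ => rfl)
      (fun _ _ _ => rfl) (fun _ _ _ _ => rfl) C D ihC ihD hC
  | seq C D ihC ihD =>
    exact bin .seq .seq (fun _ _ => rfl) (fun _ _ => rfl) (fun _ _ _ => rfl)
      (fun _ _ _ => rfl) (fun _ _ _ _ => rfl) C D ihC ihD hC
  | assign C D ihC ihD =>
    exact bin .assign .assign (fun _ _ => rfl) (fun _ _ => rfl) (fun _ _ _ => rfl)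
      (fun _ _ _ => rfl) (fun _ _ _ _ => rfl) C D ihC ihD hC
  | app C D ihC ihD =>
    exact bin .app .app (fun _ _ => rfl) (fun _ _ => rfl) (fun _ _ _ => rfl)
      (fun _ _ _ => rfl) (fun _ _ _ _ => rfl) C D ihC ihD hC
  | mkvar C D ihC ihD =>
    exact bin .mkvar .mkvar (fun _ _ => rfl) (fun _ _ => rfl) (fun _ _ _ => rfl)
      (fun _ _ _ => rfl) (fun _ _ _ _ => rfl) C D ihC ihD hC
  | deref C ih =>
    obtain ⟨F, hF⟩ := ih hC
    exact ⟨fun Q => .deref (F Q), congrArg _ hF.random, hF.randoms, hF.occ,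
      fun r h M hM Q hQ => congrArg Tm.deref (hF.fill r h M hM Q hQ)⟩
  | lam x A C ih =>
    obtain ⟨F, hF⟩ := ih hC
    refine ⟨fun Q => .lam x A (F Q), congrArg _ hF.random, hF.randoms, fun r h M hM => ?_,
      fun r h M hM Q hQ => ?_⟩
    · simp only [names, Finset.mem_insert, not_or] at h
      simpa [Context.fill, Tm.namedLam, Tm.occ, Tm.occ_closeAt (Ne.symm h.1)] using
        hF.occ r h.2 M hM
    · simp only [names, Finset.mem_insert, not_or] at h
      simp only [Context.fill, Tm.namedLam, Tm.subst]
      rw [Tm.subst_closeAt (fun k => hQ x k (Ne.symm h.1)) (Ne.symm h.1), hF.fill r h.2 M hM Q hQ]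
  | new x C ih =>
    obtain ⟨F, hF⟩ := ih hC
    refine ⟨fun Q => .new x (F Q), congrArg _ hF.random, hF.randoms, fun r h M hM => ?_,
      fun r h M hM Q hQ => ?_⟩
    · simp only [names, Finset.mem_insert, not_or] at h
      simpa [Context.fill, Tm.namedNew, Tm.occ, Tm.occ_closeAt (Ne.symm h.1)] using
        hF.occ r h.2 M hM
    · simp only [names, Finset.mem_insert, not_or] at h
      simp only [Context.fill, Tm.namedNew, Tm.subst]
      rw [Tm.subst_closeAt (fun k => hQ x k (Ne.symm h.1)) (Ne.symm h.1), hF.fill r h.2 M hM Q hQ]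
  | ifzero C D₁ D₂ ihC ih₁ ih₂ =>
    simp only [Context.randoms] at hC
    by_cases h₀ : C.randoms = 0
    · by_cases h₁ : D₁.randoms = 0
      · obtain ⟨F, hF⟩ := ih₂ (by omega)
        refine ⟨fun Q => .ifzero C D₁ (F Q), by rw [hF.random], fun Q => ?_, fun r h M hM => ?_,
          fun r h M hM Q hQ => ?_⟩
        · have := hF.randoms Q
          simp only [Context.randoms]
          omega
        · simp only [names, Finset.notMem_union] at h
          rw [Context.fill, Tm.occ, hocc C r M h.1.1 hM, hocc D₁ r M h.1.2 hM, hF.occ r h.2 M hM]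
        · simp only [names, Finset.notMem_union] at h
          rw [Context.fill, Context.fill, Tm.subst, hsub C r M _ h.1.1 hM,
            hsub D₁ r M _ h.1.2 hM, hF.fill r h.2 M hM Q hQ]
      · obtain ⟨F, hF⟩ := ih₁ h₁
        refine ⟨fun Q => .ifzero C (F Q) D₂, by rw [hF.random], fun Q => ?_, fun r h M hM => ?_,
          fun r h M hM Q hQ => ?_⟩
        · have := hF.randoms Q
          simp only [Context.randoms]
          omega
        · simp only [names, Finset.notMem_union] at h
          rw [Context.fill, Tm.occ, hocc C r M h.1.1 hM, hF.occ r h.1.2 M hM, hocc D₂ r M h.2 hM]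
        · simp only [names, Finset.notMem_union] at h
          rw [Context.fill, Context.fill, Tm.subst, hsub C r M _ h.1.1 hM,
            hF.fill r h.1.2 M hM Q hQ, hsub D₂ r M _ h.2 hM]
    · obtain ⟨F, hF⟩ := ihC h₀
      refine ⟨fun Q => .ifzero (F Q) D₁ D₂, by rw [hF.random], fun Q => ?_, fun r h M hM => ?_,
        fun r h M hM Q hQ => ?_⟩
      · have := hF.randoms Q
        simp only [Context.randoms]
        omega
      · simp only [names, Finset.notMem_union] at h
        rw [Context.fill, Tm.occ, hF.occ r h.1.1 M hM, hocc D₁ r M h.1.2 hM, hocc D₂ r M h.2 hM]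
      · simp only [names, Finset.notMem_union] at h
        rw [Context.fill, Context.fill, Tm.subst, hF.fill r h.1.1 M hM Q hQ,
          hsub D₁ r M _ h.1.2 hM, hsub D₂ r M _ h.2 hM]
  | _ C D ihC ihD =>
    exact bin .while .while (fun _ _ => rfl) (fun _ _ => rfl) (fun _ _ _ => rfl)
      (fun _ _ _ => rfl) (fun _ _ _ _ => rfl) C D ihC ihD hC

end Context

/-! ### Declaring the counter, and the induction on occurrences of `random` -/

variable {opEval : ι → ℕ → ℕ → ℕ}

theorem HasType.namedNew {L : Lang} {Γ : TyCtx} {r : ℕ} {P : Tm ι} {B : Ty}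
    (h : HasType L (Γ ++ [(r, .var)]) P B) (hP : P.LcAt 0) (hB : B = .comm ∨ B = .nat) :
    HasType L Γ (Tm.namedNew r P) B := by
  refine .new (x := r) (by simp [Tm.fv_closeAt]) ?_ hB
  rwa [Tm.inst, Tm.instAt_closeAt_self hP]

theorem Eval.namedNew_gen {r n : ℕ} {ℓ V : Tm ι} {T : List ℕ} (hℓ : ℓ.LcAt 0) (hV : r ∉ V.fv)
    (h : Eval opEval (Finmap.insert r 0 ∅) (Tm.subst r (.gen r T) ℓ) (Finmap.insert r n ∅) V) :
    Eval opEval ∅ (Tm.namedNew r (Tm.subst r (.gen r T) ℓ)) ∅ V := by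
  refine .new (x := r) (n := n) (by simp [Tm.fv_closeAt]) hV Finmap.notMem_empty
    Finmap.notMem_empty ?_
  rwa [Tm.inst, Tm.instAt_closeAt_self (Tm.lcAt_subst (Tm.lcAt_gen T) hℓ)]

/-- The location chosen by `new` is first renamed into the marker; then `Eval.subst_random` applies,
and erasing that location restores the empty store. -/
theorem Eval.of_namedNew_gen {r : ℕ} {ℓ V : Tm ι} {T : List ℕ} (hℓ : ℓ.LcAt 0)
    (hV : V = .skip ∨ ∃ n, V = .num n)
    (h : Eval opEval ∅ (Tm.namedNew r (Tm.subst r (.gen r T) ℓ)) ∅ V) :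
    Eval opEval ∅ (Tm.subst r .random ℓ) ∅ V := by
  cases h with
  | value hv => cases hv
  | @new _ _ _ _ x n hM _ _ _ h =>
    -- Freshness of `x` for the body of `new` excludes every free identifier of `ℓ` except `r`,
    -- which has been closed.
    have hx : x ∈ ℓ.fv → x = r := by
      intro hx
      by_contra hxr
      rw [Tm.fv_closeAt, Finset.mem_erase,
        Tm.mem_fv_subst (Tm.notMem_fv_gen hxr T) hxr] at hM
      exact hM ⟨hxr, hx⟩
    rw [Tm.inst, Tm.instAt_closeAt_subst_gen T hℓ hx] at h
    obtain ⟨_, W, hW, e⟩ := h.subst_random _ rfl (Finmap.mem_insert.2 (.inl rfl))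
    have hWV : W = V := by
      rcases hV with rfl | ⟨n, rfl⟩
      · exact Tm.subst_eq_skip Tm.not_isValue_gen hW
      · exact Tm.subst_eq_num Tm.not_isValue_gen hW
    have hE : Finmap.erase x (∅ : Store) = ∅ :=
      Finmap.ext_lookup fun y => by
        by_cases hy : y = x
        · subst hy; simp
        · simp [hy]
    have hWr : Tm.subst x .random W = V := by
      rcases hV with rfl | ⟨n, rfl⟩ <;> subst hWV <;> rfl
    rwa [Tm.subst_random_instAt_closeAt hℓ hx, erase_insert_self, erase_insert_self, hE, hWr] at e

/-- Induction on the occurrences of `random` in the context, each step trading one for a generator.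
As `M` and `N` have none, a context without `random` gives programs of the smaller language. -/
theorem CtxEquiv.eval_fill {M N : Tm ι} (h : CtxEquiv .mk opEval M N) (hM : M.RandomFree)
    (hN : N.RandomFree) {B : Ty} (hB : B = .comm ∨ B = .nat) {V : Tm ι} (hV : V.IsValue)
    (tV : HasType .mkran [] V B) (C : Context ι) (tM : HasType .mkran [] (C.fill M) B)
    (tN : HasType .mkran [] (C.fill N) B) (e : Eval opEval ∅ (C.fill M) ∅ V) :
    Eval opEval ∅ (C.fill N) ∅ V := by
  have hVc := tV.closed_value hV hB
  have hVfv : V.fv = ∅ := by rcases hVc with rfl | ⟨n, rfl⟩ <;> rfl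
  have hVr : V.RandomFree := by rcases hVc with rfl | ⟨n, rfl⟩ <;> trivial
  generalize hn : C.randoms = n
  induction n generalizing C with
  | zero =>
    exact (h C B hB (tM.mk_of_randomFree (Context.randomFree_fill hn hM))
      (tN.mk_of_randomFree (Context.randomFree_fill hn hN)) V hV (tV.mk_of_randomFree hVr)).1 e
  | succ n ih =>
    obtain ⟨F, hF⟩ := C.exists_isFocus (by omega)
    obtain ⟨S₁, h₁⟩ := tM.subst_gen
    obtain ⟨S₂, h₂⟩ := tN.subst_gen
    obtain ⟨S₃, h₃⟩ := e.subst_gen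
    -- One marker has to suit both typing derivations and the evaluation of `C[M]`, because the new
    -- context must be the same for `M` and `N`.
    obtain ⟨r, hr⟩ := Infinite.exists_notMem_finset (S₁ ∪ S₂ ∪ S₃ ∪ C.names ∪ M.fv ∪ N.fv)
    simp only [Finset.notMem_union] at hr
    obtain ⟨⟨⟨⟨⟨hr₁, hr₂⟩, hr₃⟩, hrC⟩, hrM⟩, hrN⟩ := hr
    have hrand : ∀ P : Tm ι, r ∉ P.fv →
        Tm.subst r .random ((F (.id r)).fill P) = C.fill P := fun P hP => by
      have := hF.fill r hrC P hP .random (fun _ _ _ => rfl)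
      rw [hF.random] at this
      exact this.symm
    have hgen : ∀ P : Tm ι, r ∉ P.fv → ∀ T,
        (Context.new r (F (.gen r T))).fill P =
          Tm.namedNew r (Tm.subst r (.gen r T) ((F (.id r)).fill P)) := fun P hP T => by
      have := hF.fill r hrC P hP (.gen r T) (fun x k hx => by
        rw [Context.fill_gen, Tm.closeAt_gen hx])
      rw [Context.fill, this, Context.fill_gen]
    have lM : ((F (.id r)).fill M).LcAt 0 := Tm.lcAt_of_subst (hrand M hrM ▸ tM.lcAt)
    have lN : ((F (.id r)).fill N).LcAt 0 := Tm.lcAt_of_subst (hrand N hrN ▸ tN.lcAt)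
    obtain ⟨ns, W, hW, e'⟩ := h₃ r hr₃ _ (hrand M hrM)
    have hWV : Tm.subst r (.gen r ns) W = V := by
      rcases hVc with rfl | ⟨n, rfl⟩
      · rw [Tm.subst_eq_skip Tm.not_isValue_random hW, Tm.subst]
      · rw [Tm.subst_eq_num Tm.not_isValue_random hW, Tm.subst]
    -- The table is exactly the list of numbers drawn, read from index `0`, the initial value given
    -- by `new`.
    have e' := e' ns 0 (List.prefix_refl ns)
    rw [hWV] at e'
    have key := ih (.new r (F (.gen r ns)))
      (hgen M hrM ns ▸ (h₁ r hr₁ _ (hF.occ r hrC M hrM).le (hrand M hrM) ns).namedNew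
        (Tm.lcAt_subst (Tm.lcAt_gen ns) lM) hB)
      (hgen N hrN ns ▸ (h₂ r hr₂ _ (hF.occ r hrC N hrN).le (hrand N hrN) ns).namedNew
        (Tm.lcAt_subst (Tm.lcAt_gen ns) lN) hB)
      (hgen M hrM ns ▸ Eval.namedNew_gen lM (by simp [hVfv]) e')
      (by
        have := hF.randoms (.gen r ns)
        rw [Context.randoms_gen] at this
        rw [Context.randoms]
        omega)
    rw [hgen N hrN] at key
    -- With `N` the generator may be called differently from the run of `M`, or beyond the table;
    -- the run is still one possible with `random`.
    exact hrand N hrN ▸ Eval.of_namedNew_gen lN hVc key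

end SCI

theorem mainTheorem4 {ι : Type*} (opEval : ι → ℕ → ℕ → ℕ)
    (Γ : SCI.TyCtx) (A : SCI.Ty) (M N : SCI.Tm ι)
    (hM : SCI.HasType .mk Γ M A) (hN : SCI.HasType .mk Γ N A)
    (h : SCI.CtxEquiv .mk opEval M N) :
    SCI.CtxEquiv .mkran opEval M N := by
  have h' : SCI.CtxEquiv .mk opEval N M := fun C B hB tN tM V hV tV =>
    (h C B hB tM tN V hV tV).symm
  exact fun C B hB tM tN V hV tV =>
    ⟨h.eval_fill hM.randomFree hN.randomFree hB hV tV C tM tN,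
      h'.eval_fill hN.randomFree hM.randomFree hB hV tV C tN tM⟩
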